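/- **Problem.** An instance of service network design with restricted routes (SND-RR) consists of a finite directed graph $D=(N,A)$, a nonempty finite set $\mathcal K$ of commodities, and, for each arc $vw\in A$, a transit time $\tau_{vw}\in\mathbb N_{>0}$, per-unit costs $c^k_{vw}>0$ ($k\in\mathcal K$), a fixed cost $f_{vw}>0$ and a capacity $u_{vw}\in\mathbb N_{>0}$. Each commodity $k$ has an origin $o_k$ and a destination $d_k\ne o_k$, a demand $q_k>0$, a release time $r_k\in\mathbb N$, a deadline $l_k\in\mathbb N$, and a designated subgraph $D^k=(N^k,A^k)\subseteq D$ containing $o_k,d_k$, such that no arc of $D^k$ leaves $d_k$ and every other node of $D^k$ has an outgoing arc in $D^k$. Let $T=\max_k l_k$. The full network $D_T$ has timed nodes $N\times\{0,\dots,T\}$, movement arcs $((v,t),(w,t+\tau_{vw}))$ and storage arcs $((v,t),(v,t+1))$; $D^k_T$ is its part over $D^k$. SND-RR($D_T$) is: minimize $\sum_a f_ay_a+\sum_k\sum_a c^k_aq_kx^k_a$ ($a$ over the movement arcs) where $x^k$ is a binary unit flow from $(o_k,r_k)$ to $(d_k,l_k)$ in $D_T^k$, $y_a\in\mathbb N$,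 and $\sum_kq_kx_a^k\le u_ay_a$ for each movement arc $a$. Assume that it is feasible. **Auxiliary network.** For each $v\in N$ let $\mathcal A_v$ be a partition of the arcs of $D$ leaving $v$ into nonempty parts such that for each $k$ the arcs of $D^k$ leaving $v$ (if any) lie in one part. The graph $G=(V,E)$ has, for each $v\in N$, a node $v^i$ for each part $A_i\in\mathcal A_v$ and a terminal node $v^0$; its arcs are all $v^iw^j$ with $vw\in A_i$ and $w^j$ a copy of $w$. Times and costs are inherited from $D$. The subgraph $G^k$ contains the copy $v^i$ of $v\in N^k\setminus\{d_k\}$ for which $A_i$ contains the arcs of $D^k$ leaving $v$, the node $d_k^0$, and the copies of the arcs of $A^k$ between these nodes; $o_k'$ is the copy of $o_k$ in $G^k$. SND-RR($G_T$) is the analogous formulation over the full network $G_T$, with flows from $(o'_k,r_k)$ to $(d^0_k,l_k)$ in $G_T^k$, trucks $y_a$ still indexed by movement arcs $a$ of $D_T$, and the load of $a$ summed over all copies of $a$ in $G_T$. For a set $V_S$ of timed nodes of $G$, the partial network $G_S$ has the movement arcs $((v,t),(w,t'))$ with $vw\in E$, $(v,t)\in V_S$, $t+\tau_{vw}\le T$,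 $t'=\max\{s\le t+\tau_{vw}:(w,s)\in V_S\}$, and storage arcs between consecutive copies of a node; the arc is *short* if $t'<t+\tau_{vw}$. SND-RR($G_S$) is the analogous formulation over $G_S$, in which there is one truck variable for each movement arc of the partial network on $D$ given by the projected timed nodes, i.e. for each flat arc $vw\in A$ and departure time $t\le T-\tau_{vw}$ at which some copy of $v$ belongs to $V_S$; its load is the total demand on all movement arcs of $G_S$ that are copies of $vw$ departing at $t$. There is the additional constraint $\sum_e\tau_ex^k_e\le l_k-r_k$ for each $k$, with the actual transit times $\tau_e$. **Algorithm (arc-based DDD).** Start with the set $V_S$ consisting of all $(o_k',r_k)$ and $(d_k^0,l_k)$, all $(v^0,T)$ with $v\in N$ and all $(u,0)$ with $u\in V$. In each iteration: 1. Take an optimal solution $(\hat x,\hat y)$ of SND-RR($G_S$) and its trajectories $Q_k$. 2. Let $\mathcal K^F$ be the set of commodities whose $Q_k$ has no short arc. With a departure time variable $t^k_p$ for the $p$-th movement of each $Q_k$, take an optimal solution $(\bar t,\bar\delta)$, with integral $\bar t$, of the linear program that minimizes the sum of the variables $\delta$ over all ordered pairs of movements that in $Q$ use copies of the same flat arc with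 the same departure time, subject to: $\delta$ is at least the absolute difference of the two departure times; $t^k_p+\tau\le t^k_{p+1}$ for consecutive movements; $t^k_p\ge r_k$ for the first movement; $t^k_p+\tau\le l_k$ for the last one; and $t_p^k$ is the departure time in $Q_k$ for all $k\in\mathcal K^F$. Let $(\bar x,\bar y)$ be the solution over $G_T$ that moves each commodity along the path of $Q_k$ at the times $\bar t$, with $\bar y_a$ the load of $a$ divided by $u_a$, rounded up, and let $\mathcal C$ be the set of all $k\notin\mathcal K^F$ with a movement that is the first member of a pair with $\bar\delta>0$. 3. If $(\bar x,\bar y)$ and $(\hat x,\hat y)$ have the same cost, stop with output $(\bar x,\bar y)$. Otherwise choose for each $k\in\mathcal C$ a short arc $((v,t),(w,t'))$ of $Q_k$ with the smallest $t$, add all the timed nodes $(w,t+\tau_{vw})$ so obtained to $V_S$, and go to the next iteration. **Theorem.** Whatever choices are made among optimal solutions and among ties, every step of the algorithm can be carried out, and the algorithm stops within at most $|V|\cdot T$ iterations. Its output $(\bar x,\bar y)$ is an optimal solution of SND-RR($G_T$), and its projection to $D_T$ is an optimal solution of SND-RR($D_T$) of the same cost. -/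

import Mathlib

noncomputable section

namespace SNDRR

/-- An instance of service network design with restricted routes: the flat network is
`(N, arcs)`, commodity `k` is routed inside the designated subgraph
`(knodes k, karcs k)`.  The last two fields say that no arc of the designated subgraph leaves the
destination, and that every other node of the designated subgraph has an outgoing arc in it. -/
structure Instance (N K : Type*) where
  /-- the arcs of the flat network -/
  arcs : Finset (N × N)
  /-- transit times -/
  τ : N × N → ℕ
  /-- variable costs per unit of flow -/
  c : K → N × N → ℝ
  /-- fixed cost of a truck -/
  f : N × N → ℝ
  /-- capacity of a truck -/
  u : N × N → ℕ
  /-- origins -/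
  o : K → N
  /-- destinations -/
  d : K → N
  /-- demands -/
  q : K → ℝ
  /-- release times -/
  r : K → ℕ
  /-- deadlines -/
  l : K → ℕ
  /-- nodes of the designated subgraphs -/
  knodes : K → Finset N
  /-- arcs of the designated subgraphs -/
  karcs : K → Finset (N × N)
  τ_pos : ∀ a ∈ arcs, 0 < τ a
  c_pos : ∀ k, ∀ a ∈ arcs, 0 < c k a
  f_pos : ∀ a ∈ arcs, 0 < f a
  u_pos : ∀ a ∈ arcs, 0 < u a
  q_pos : ∀ k, 0 < q k
  o_ne_d : ∀ k, o k ≠ d k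
  karcs_subset : ∀ k, karcs k ⊆ arcs
  fst_mem : ∀ k, ∀ a ∈ karcs k, a.1 ∈ knodes k
  snd_mem : ∀ k, ∀ a ∈ karcs k, a.2 ∈ knodes k
  o_mem : ∀ k, o k ∈ knodes k
  d_mem : ∀ k, d k ∈ knodes k
  no_out_d : ∀ k, ∀ a ∈ karcs k, a.1 ≠ d k
  exists_out : ∀ k, ∀ v ∈ knodes k, v ≠ d k → ∃ a ∈ karcs k, a.1 = v

/-! ### Timed nodes, timed arcs and networks over an arbitrary flat node type -/

section Networks

/-- A timed node `(v, t)`. -/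
abbrev TNode (W : Type*) := W × ℕ

/-- A pair of timed nodes `((v, t), (w, t'))`. -/
abbrev TPair (W : Type*) := TNode W × TNode W

/-- A timed arc: `Sum.inl` marks a movement arc, `Sum.inr` a storage (holdover) arc. -/
abbrev TArc (W : Type*) := TPair W ⊕ TPair W

/-- The timed node a timed arc leaves. -/
def tail {W : Type*} (e : TArc W) : TNode W := Sum.elim Prod.fst Prod.fst e

/-- The timed node a timed arc enters. -/
def head {W : Type*} (e : TArc W) : TNode W := Sum.elim Prod.snd Prod.snd e

/-- A (full or partial) time-expanded network. -/
structure Network (W : Type*) where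
  /-- timed nodes -/
  nodes : Finset (TNode W)
  /-- movement arcs -/
  move : Finset (TPair W)
  /-- storage arcs -/
  hold : Finset (TPair W)

/-- All timed arcs of a network. -/
def Network.arcs {W : Type*} (net : Network W) : Finset (TArc W) := net.move.disjSum net.hold

open Classical in
/-- The part of a network that lies over the subgraph `(nodes, arcs)` of the flat network. -/
def Network.restrict {W : Type*} (net : Network W) (nodes : Finset W) (arcs : Finset (W × W)) :
    Network W where
  nodes := net.nodes.filter fun p => p.1 ∈ nodes
  move := net.move.filter fun e => (e.1.1, e.2.1) ∈ arcs
  hold := net.hold.filter fun e => e.1.1 ∈ nodes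

open Classical in
/-- The full time-expanded network of the flat network `(W, arcs)` with time horizon `T`. -/
def fullNetwork {W : Type*} [Fintype W] (arcs : Finset (W × W)) (τ : W × W → ℕ) (T : ℕ) :
    Network W where
  nodes := Finset.univ ×ˢ Finset.range (T + 1)
  move := ((Finset.univ ×ˢ Finset.range (T + 1)) ×ˢ (Finset.univ ×ˢ Finset.range (T + 1))).filter
    fun e => (e.1.1, e.2.1) ∈ arcs ∧ e.2.2 = e.1.2 + τ (e.1.1, e.2.1)
  hold := ((Finset.univ ×ˢ Finset.range (T + 1)) ×ˢ (Finset.univ ×ˢ Finset.range (T + 1))).filter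
    fun e => e.2.1 = e.1.1 ∧ e.2.2 = e.1.2 + 1

open Classical in
/-- The partial network determined by a set `S` of timed nodes: for `(v, t) ∈ S` and an arc `vw`
with `t + τ ≤ T` there is the movement arc `((v, t), (w, t'))` where `t'` is the largest time
with `t' ≤ t + τ` and `(w, t') ∈ S`; storage arcs join consecutive copies of a node. -/
def partialNetwork {W : Type*} (arcs : Finset (W × W)) (τ : W × W → ℕ) (T : ℕ)
    (S : Finset (TNode W)) : Network W where
  nodes := S
  move := (S ×ˢ S).filter fun e =>
    (e.1.1, e.2.1) ∈ arcs ∧ e.1.2 + τ (e.1.1, e.2.1) ≤ T ∧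
      e.2.2 ≤ e.1.2 + τ (e.1.1, e.2.1) ∧
      ∀ s, (e.2.1, s) ∈ S → s ≤ e.1.2 + τ (e.1.1, e.2.1) → s ≤ e.2.2
  hold := (S ×ˢ S).filter fun e =>
    e.2.1 = e.1.1 ∧ e.1.2 < e.2.2 ∧ ∀ s, (e.1.1, s) ∈ S → ¬ (e.1.2 < s ∧ s < e.2.2)

open Classical in
/-- `x` is a binary vector indexed by the arcs of `net` (extended by zero) which satisfies the
flow constraints that send one unit from `src` to `snk`. -/
def IsUnitFlow {W : Type*} (net : Network W) (src snk : TNode W) (x : TArc W → ℕ) : Prop :=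
  (∀ e, x e = 0 ∨ x e = 1) ∧ (∀ e, e ∉ net.arcs → x e = 0) ∧
    ∀ p ∈ net.nodes,
      (∑ e ∈ net.arcs.filter (fun e => tail e = p), (x e : ℤ)) -
        (∑ e ∈ net.arcs.filter (fun e => head e = p), (x e : ℤ)) =
      if p = src then 1 else if p = snk then -1 else 0

/-- `L` is the list of consecutive arcs of a (node-simple) path of `net` from `src` to `snk`,
that is, a trajectory. -/
def IsTrajectory {W : Type*} (net : Network W) (src snk : TNode W) (L : List (TArc W)) : Prop :=
  (∀ e ∈ L, e ∈ net.arcs) ∧ L.IsChain (fun e e' => head e = tail e') ∧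
    L.head?.map tail = some src ∧ L.getLast?.map head = some snk ∧
    (L.map tail ++ [snk]).Nodup

/-- The movement arcs of a trajectory, in order. -/
def moves {W : Type*} (L : List (TArc W)) : List (TPair W) := L.filterMap Sum.getLeft?

end Networks

/-- A candidate solution `(x, y)`: commodity `k` uses timed arc `e` iff `x k e = 1`, and `y a` is
the number of trucks on the timed arc `a` of the original flat network. -/
structure Solution (W N K : Type*) where
  /-- flow variables -/
  x : K → TArc W → ℕ
  /-- numbers of trucks -/
  y : TPair N → ℕ

section Formulations

variable {N K : Type*} [Fintype K]

/-- The time horizon: the latest deadline. -/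
def Instance.T (I : Instance N K) : ℕ := Finset.univ.sup I.l

/-- The arc of the original flat network under a movement arc; `π` sends a node to the original
node of which it is a copy. -/
def baseArc {W : Type*} (π : W → N) (e : TPair W) : N × N := (π e.1.1, π e.2.1)

/-- The total demand that `x` puts on a set of movement arcs. -/
def load {W : Type*} (I : Instance N K) (s : Finset (TPair W)) (x : K → TArc W → ℕ) : ℝ :=
  ∑ k, ∑ e ∈ s, I.q k * (x k (Sum.inl e) : ℝ)

/-- Variable cost of `x`, where `s` is the set of movement arcs. -/
def variableCost {W : Type*} (I : Instance N K) (π : W → N) (s : Finset (TPair W))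
    (x : K → TArc W → ℕ) : ℝ :=
  ∑ k, ∑ e ∈ s, I.c k (baseArc π e) * I.q k * (x k (Sum.inl e) : ℝ)

/-- Fixed cost of `y`, where `s` is the set of movement arcs on which trucks are scheduled. -/
def fixedCost (I : Instance N K) (s : Finset (TPair N)) (y : TPair N → ℕ) : ℝ :=
  ∑ a ∈ s, I.f (baseArc id a) * (y a : ℝ)

/-- `z` minimizes `cost` over the feasible solutions. -/
def IsOptimal {W : Type*} (Feasible : Solution W N K → Prop) (cost : Solution W N K → ℝ)
    (z : Solution W N K) : Prop :=
  Feasible z ∧ ∀ z', Feasible z' → cost z ≤ cost z'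

variable [Fintype N]

/-! ### The formulation SND-RR(`D_T`) -/

/-- The full network `D_T`. -/
def Instance.DT (I : Instance N K) : Network N := fullNetwork I.arcs I.τ I.T

/-- Feasibility for SND-RR(`D_T`). -/
def Instance.FeasibleDT (I : Instance N K) (z : Solution N N K) : Prop :=
  (∀ k, IsUnitFlow (I.DT.restrict (I.knodes k) (I.karcs k)) (I.o k, I.r k) (I.d k, I.l k)
    (z.x k)) ∧
  ∀ a ∈ I.DT.move, load I {a} z.x ≤ (I.u (baseArc id a) : ℝ) * (z.y a : ℝ)

/-- Objective of SND-RR(`D_T`). -/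
def Instance.costDT (I : Instance N K) (z : Solution N N K) : ℝ :=
  fixedCost I I.DT.move z.y + variableCost I id I.DT.move z.x

/-- Optimal solutions of SND-RR(`D_T`). -/
def Instance.OptimalDT (I : Instance N K) (z : Solution N N K) : Prop :=
  IsOptimal I.FeasibleDT I.costDT z

/-! ### Valid arc partitions and the auxiliary network -/

variable [DecidableEq N]

/-- The arcs of the flat network leaving `v`. -/
def Instance.out (I : Instance N K) (v : N) : Finset (N × N) := I.arcs.filter fun a => a.1 = v

/-- The arcs of the designated subgraph of `k` leaving `v`. -/
def Instance.kout (I : Instance N K) (k : K) (v : N) : Finset (N × N) :=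
  (I.karcs k).filter fun a => a.1 = v

/-- A valid arc partition: the arcs leaving `v` are partitioned (into nonempty parts) such that the
arcs that a commodity may use to leave `v` lie in a single part. -/
structure ValidPartition (I : Instance N K) where
  /-- the partition of the arcs leaving `v` -/
  part : ∀ v, Finpartition (I.out v)
  valid : ∀ k v, (I.kout k v).Nonempty → ∃ B ∈ (part v).parts, I.kout k v ⊆ B

variable {I : Instance N K}

/-- The nodes of the auxiliary flat network `G`: for each node `v` one copy per part of its
partition, and the terminal copy `⟨v, none⟩`. -/
abbrev AuxNode (P : ValidPartition I) := Σ v : N, Option {B // B ∈ (P.part v).parts}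

open Classical in
/-- The arcs of `G`: all `vᵢ wⱼ` such that `vw` belongs to the part of `vᵢ`. -/
def auxArcs (P : ValidPartition I) : Finset (AuxNode P × AuxNode P) :=
  Finset.univ.filter fun e => ∃ B, e.1.2 = some B ∧ (e.1.1, e.2.1) ∈ B.1

/-- The transit time of an arc of `G` is that of the underlying arc. -/
def auxτ (P : ValidPartition I) (e : AuxNode P × AuxNode P) : ℕ := I.τ (e.1.1, e.2.1)

open Classical in
/-- The nodes of the designated subgraph of `k` in `G`. -/
def auxNodes (P : ValidPartition I) (k : K) : Finset (AuxNode P) :=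
  Finset.univ.filter fun n =>
    (∃ B, n.2 = some B ∧ n.1 ∈ I.knodes k ∧ (I.kout k n.1).Nonempty ∧ I.kout k n.1 ⊆ B.1) ∨
      n = ⟨I.d k, none⟩

open Classical in
/-- The arcs of the designated subgraph of `k` in `G`. -/
def auxKArcs (P : ValidPartition I) (k : K) : Finset (AuxNode P × AuxNode P) :=
  Finset.univ.filter fun e =>
    (e.1.1, e.2.1) ∈ I.karcs k ∧ e.1 ∈ auxNodes P k ∧ e.2 ∈ auxNodes P k

/-- The designated subgraph of `k` in `G` contains exactly one copy of the origin of `k`. -/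
theorem existsUnique_origin (P : ValidPartition I) (k : K) :
    ∃! n : AuxNode P, n ∈ auxNodes P k ∧ n.1 = I.o k := by
  classical
  obtain ⟨a, ha, hav⟩ := I.exists_out k (I.o k) (I.o_mem k) (I.o_ne_d k)
  have hmem : a ∈ I.kout k (I.o k) := Finset.mem_filter.2 ⟨ha, hav⟩
  obtain ⟨B, hB, hsub⟩ := P.valid k (I.o k) ⟨a, hmem⟩
  refine ⟨⟨I.o k, some ⟨B, hB⟩⟩, ⟨?_, rfl⟩, ?_⟩
  · exact Finset.mem_filter.2 ⟨Finset.mem_univ _,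
      Or.inl ⟨⟨B, hB⟩, rfl, I.o_mem k, ⟨a, hmem⟩, hsub⟩⟩
  · have key : ∀ b : Option {B // B ∈ (P.part (I.o k)).parts},
        (⟨I.o k, b⟩ : AuxNode P) ∈ auxNodes P k → b = some ⟨B, hB⟩ := by
      intro b hn
      rcases (Finset.mem_filter.1 hn).2 with ⟨B', hb, -, -, hsub'⟩ | h
      · exact hb.trans (congrArg some (Subtype.ext
          ((P.part (I.o k)).eq_of_mem_parts B'.2 hB (hsub' hmem) (hsub hmem))))
      · exact absurd (congrArg Sigma.fst h) (I.o_ne_d k)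
    rintro ⟨v, b⟩ ⟨hn, hv⟩
    dsimp only at hv
    subst hv
    rw [key b hn]

/-- The copy of the origin of `k` in its designated subgraph of `G`. -/
def auxOrigin (P : ValidPartition I) (k : K) : AuxNode P := (existsUnique_origin P k).choose

/-- The timed node of `G` at which commodity `k` is released. -/
def source (P : ValidPartition I) (k : K) : TNode (AuxNode P) := (auxOrigin P k, I.r k)

/-- The timed node of `G` at which commodity `k` is due. -/
def sink (P : ValidPartition I) (k : K) : TNode (AuxNode P) := (⟨I.d k, none⟩, I.l k)

/-- The original node of which a node of `G` is a copy. -/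
def proj (P : ValidPartition I) (n : AuxNode P) : N := n.1

/-! ### The formulation SND-RR(`G_T`) -/

/-- The full network `G_T`. -/
def GT (P : ValidPartition I) : Network (AuxNode P) := fullNetwork (auxArcs P) (auxτ P) I.T

open Classical in
/-- The copies in `G_T` of a timed arc of `D_T`. -/
def copiesT (P : ValidPartition I) (a : TPair N) : Finset (TPair (AuxNode P)) :=
  (GT P).move.filter fun e => ((e.1.1.1, e.1.2), (e.2.1.1, e.2.2)) = a

/-- Feasibility for SND-RR(`G_T`). -/
def FeasibleGT (P : ValidPartition I) (z : Solution (AuxNode P) N K) : Prop :=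
  (∀ k, IsUnitFlow ((GT P).restrict (auxNodes P k) (auxKArcs P k)) (source P k) (sink P k)
    (z.x k)) ∧
  ∀ a ∈ I.DT.move, load I (copiesT P a) z.x ≤ (I.u (baseArc id a) : ℝ) * (z.y a : ℝ)

/-- Objective of SND-RR(`G_T`). -/
def costGT (P : ValidPartition I) (z : Solution (AuxNode P) N K) : ℝ :=
  fixedCost I I.DT.move z.y + variableCost I (proj P) (GT P).move z.x

/-- Optimal solutions of SND-RR(`G_T`). -/
def OptimalGT (P : ValidPartition I) (z : Solution (AuxNode P) N K) : Prop :=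
  IsOptimal (FeasibleGT P) (costGT P) z

/-- The timed arc of `D_T` of which a timed arc of `G_T` is a copy. -/
def projArc (P : ValidPartition I) (e : TArc (AuxNode P)) : TArc N :=
  Sum.map (fun e => ((e.1.1.1, e.1.2), (e.2.1.1, e.2.2)))
    (fun e => ((e.1.1.1, e.1.2), (e.2.1.1, e.2.2))) e

open Classical in
/-- The solution over `D_T` obtained from one over `G_T` by projecting every timed arc copy to its
timed arc. -/
def project (P : ValidPartition I) (z : Solution (AuxNode P) N K) : Solution N N K where
  x k a := ∑ e ∈ (GT P).arcs.filter (fun e => projArc P e = a), z.x k e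
  y := z.y

/-! ### The lower bound formulation SND-RR(`G_S`)

A partial network of `G` is determined by its set `S` of timed nodes. -/

/-- The partial network `G_S`. -/
def GS (P : ValidPartition I) (S : Finset (TNode (AuxNode P))) : Network (AuxNode P) :=
  partialNetwork (auxArcs P) (auxτ P) I.T S

/-- The partial network `D_S(G_S)` on the original flat network: its timed nodes are those of which
some copy belongs to `S`. -/
def DS (P : ValidPartition I) (S : Finset (TNode (AuxNode P))) : Network N :=
  partialNetwork I.arcs I.τ I.T (S.image fun p => (p.1.1, p.2))

open Classical in
/-- The timed arcs of `G_S` that are copies of the flat arc under `a` and depart when `a` does; the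
arrival times need not agree. -/
def copiesS (P : ValidPartition I) (S : Finset (TNode (AuxNode P))) (a : TPair N) :
    Finset (TPair (AuxNode P)) :=
  (GS P S).move.filter fun e => (e.1.1.1, e.1.2) = a.1 ∧ e.2.1.1 = a.2.1

/-- Feasibility for SND-RR(`G_S`). -/
def FeasibleGS (P : ValidPartition I) (S : Finset (TNode (AuxNode P)))
    (z : Solution (AuxNode P) N K) : Prop :=
  (∀ k, IsUnitFlow ((GS P S).restrict (auxNodes P k) (auxKArcs P k)) (source P k) (sink P k)
    (z.x k)) ∧
  (∀ a ∈ (DS P S).move,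
    load I (copiesS P S a) z.x ≤ (I.u (baseArc id a) : ℝ) * (z.y a : ℝ)) ∧
  ∀ k, (∑ e ∈ ((GS P S).restrict (auxNodes P k) (auxKArcs P k)).move,
    (I.τ (baseArc (proj P) e) : ℤ) * (z.x k (Sum.inl e) : ℤ)) ≤ (I.l k : ℤ) - (I.r k : ℤ)

/-- Objective of SND-RR(`G_S`). -/
def costGS (P : ValidPartition I) (S : Finset (TNode (AuxNode P)))
    (z : Solution (AuxNode P) N K) : ℝ :=
  fixedCost I (DS P S).move z.y + variableCost I (proj P) (GS P S).move z.x

/-- Optimal solutions of SND-RR(`G_S`). -/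
def OptimalGS (P : ValidPartition I) (S : Finset (TNode (AuxNode P)))
    (z : Solution (AuxNode P) N K) : Prop :=
  IsOptimal (FeasibleGS P S) (costGS P S) z

/-! ### The upper bound procedure -/

/-- `Q` is the family of trajectories in `G_S` given by the flow `x`. -/
def TrajectoriesOf (P : ValidPartition I) (S : Finset (TNode (AuxNode P)))
    (x : K → TArc (AuxNode P) → ℕ) (Q : K → List (TArc (AuxNode P))) : Prop :=
  ∀ k, IsTrajectory (GS P S) (source P k) (sink P k) (Q k) ∧ ∀ e, e ∈ Q k ↔ x k e = 1

/-- The traversals of arcs: `⟨k, p⟩` is the `p`-th movement (counted from `0`) of commodity `k`. -/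
abbrev Traversal {W : Type*} (Q : K → List (TArc W)) := Σ k : K, Fin (moves (Q k)).length

/-- The movement arc of a traversal. -/
def Traversal.arc {W : Type*} {Q : K → List (TArc W)} (s : Traversal Q) : TPair W :=
  (moves (Q s.1)).get s.2

/-- A movement arc with less than its actual transit time. -/
def IsShort (P : ValidPartition I) (e : TPair (AuxNode P)) : Prop :=
  e.2.2 < e.1.2 + I.τ (baseArc (proj P) e)

open Classical in
/-- The commodities whose trajectories consist of timed arcs with actual transit times. -/
def KF (P : ValidPartition I) (S : Finset (TNode (AuxNode P)))
    (x : K → TArc (AuxNode P) → ℕ) : Finset K :=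
  Finset.univ.filter fun k => ∀ e ∈ (GS P S).move, 0 < x k (Sum.inl e) →
    e.2.2 = e.1.2 + I.τ (baseArc (proj P) e)

open Classical in
/-- The pairs of traversals of the flat arc `b` that are consolidated in `G_S`: they use copies in
the same set `copiesS P S a`, for some timed arc `a` over `b`. -/
def J (P : ValidPartition I) (S : Finset (TNode (AuxNode P)))
    (Q : K → List (TArc (AuxNode P))) (b : N × N) : Finset (Traversal Q × Traversal Q) :=
  Finset.univ.filter fun s => ∃ a ∈ (DS P S).move, baseArc id a = b ∧
    s.1.arc ∈ copiesS P S a ∧ s.2.arc ∈ copiesS P S a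

/-- Feasibility for the linear program that retimes the trajectories: `t` gives departure times of
the traversals, `δ` bounds the differences of departure times of consolidated traversals. -/
structure FeasibleLP (P : ValidPartition I) (S : Finset (TNode (AuxNode P)))
    (x : K → TArc (AuxNode P) → ℕ) (Q : K → List (TArc (AuxNode P)))
    (t : Traversal Q → ℝ) (δ : N × N → Traversal Q → Traversal Q → ℝ) : Prop where
  transit : ∀ k (p p' : Fin (moves (Q k)).length), p'.val = p.val + 1 →
    t ⟨k, p⟩ + (I.τ (baseArc (proj P) (Traversal.arc ⟨k, p⟩)) : ℝ) ≤ t ⟨k, p'⟩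
  release : ∀ k (p : Fin (moves (Q k)).length), p.val = 0 → (I.r k : ℝ) ≤ t ⟨k, p⟩
  deadline : ∀ k (p : Fin (moves (Q k)).length), p.val + 1 = (moves (Q k)).length →
    t ⟨k, p⟩ + (I.τ (baseArc (proj P) (Traversal.arc ⟨k, p⟩)) : ℝ) ≤ (I.l k : ℝ)
  consolidate : ∀ b ∈ I.arcs, ∀ s ∈ J P S Q b, t s.1 - t s.2 ≤ δ b s.1 s.2
  consolidate' : ∀ b ∈ I.arcs, ∀ s ∈ J P S Q b, t s.2 - t s.1 ≤ δ b s.1 s.2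
  fixed : ∀ s : Traversal Q, s.1 ∈ KF P S x → t s = (s.arc.1.2 : ℝ)

/-- Objective of the linear program. -/
def costLP (P : ValidPartition I) (S : Finset (TNode (AuxNode P)))
    (Q : K → List (TArc (AuxNode P))) (δ : N × N → Traversal Q → Traversal Q → ℝ) : ℝ :=
  ∑ b ∈ I.arcs, ∑ s ∈ J P S Q b, δ b s.1 s.2

/-- Optimal solutions of the linear program. -/
def OptimalLP (P : ValidPartition I) (S : Finset (TNode (AuxNode P)))
    (x : K → TArc (AuxNode P) → ℕ) (Q : K → List (TArc (AuxNode P)))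
    (t : Traversal Q → ℝ) (δ : N × N → Traversal Q → Traversal Q → ℝ) : Prop :=
  FeasibleLP P S x Q t δ ∧ ∀ t' δ', FeasibleLP P S x Q t' δ' → costLP P S Q δ ≤ costLP P S Q δ'

open Classical in
/-- `z` is the solution over `G_T` given by the flat paths of `Q` and the departure times `t`: each
commodity follows the trajectory in `G_T` that makes the movements of `Q` at the times `t` with
actual transit times, and the least sufficient number of trucks is scheduled. -/
def SolutionOfTimes (P : ValidPartition I) (Q : K → List (TArc (AuxNode P)))
    (t : Traversal Q → ℕ) (z : Solution (AuxNode P) N K) : Prop :=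
  (∃ Q' : K → List (TArc (AuxNode P)), ∀ k,
    IsTrajectory (GT P) (source P k) (sink P k) (Q' k) ∧
    moves (Q' k) = List.ofFn (fun p : Fin (moves (Q k)).length =>
      (((Traversal.arc ⟨k, p⟩).1.1, t ⟨k, p⟩),
        ((Traversal.arc ⟨k, p⟩).2.1,
          t ⟨k, p⟩ + I.τ (baseArc (proj P) (Traversal.arc ⟨k, p⟩))))) ∧
    ∀ e, z.x k e = if e ∈ Q' k then 1 else 0) ∧
  ∀ a, z.y a = ⌈load I (copiesT P a) z.x / (I.u (baseArc id a) : ℝ)⌉₊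

/-- `(z, C)` is a possible output of the upper bound procedure, given the optimal flow `x` of
SND-RR(`G_S`) with trajectories `Q`: it is obtained from an optimal solution of the linear program
with integral departure times, and `C` collects the commodities with short timed arcs that have a
positive `δ`. -/
def UpperBound (P : ValidPartition I) (S : Finset (TNode (AuxNode P)))
    (x : K → TArc (AuxNode P) → ℕ) (Q : K → List (TArc (AuxNode P)))
    (z : Solution (AuxNode P) N K) (C : Finset K) : Prop :=
  ∃ (t : Traversal Q → ℕ) (δ : N × N → Traversal Q → Traversal Q → ℝ),
    OptimalLP P S x Q (fun s => (t s : ℝ)) δ ∧ SolutionOfTimes P Q t z ∧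
    ∀ k, k ∈ C ↔ k ∉ KF P S x ∧ ∃ b ∈ I.arcs, ∃ s ∈ J P S Q b, s.1.1 = k ∧ 0 < δ b s.1 s.2

/-! ### The algorithm -/

open Classical in
/-- The minimal set of timed nodes that contains all sources and sinks of commodities, all terminal
copies at time `T`, and all nodes of `G` at time `0`. -/
def initialNodes (P : ValidPartition I) : Finset (TNode (AuxNode P)) :=
  (Finset.univ.image fun k => source P k) ∪ (Finset.univ.image fun k => sink P k) ∪
    (Finset.univ.image fun v : N => ((⟨v, none⟩ : AuxNode P), I.T)) ∪
    (Finset.univ.image fun n : AuxNode P => (n, 0))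

/-- `e` is a short timed arc of the trajectory `L` with the earliest departure time. -/
def EarliestShort (P : ValidPartition I) (L : List (TArc (AuxNode P)))
    (e : TPair (AuxNode P)) : Prop :=
  e ∈ moves L ∧ IsShort P e ∧ ∀ e' ∈ moves L, IsShort P e' → e.1.2 ≤ e'.1.2

open Classical in
/-- `S'` arises from `S` by lengthening, for each `k ∈ C`, an earliest short timed arc
`((v, t), (w, t'))` of `Q k`: the timed node `(w, t + τ)` is added. -/
def Refines (P : ValidPartition I) (S : Finset (TNode (AuxNode P)))
    (Q : K → List (TArc (AuxNode P))) (C : Finset K) (S' : Finset (TNode (AuxNode P))) : Prop :=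
  ∃ e : K → TPair (AuxNode P), (∀ k ∈ C, EarliestShort P (Q k) (e k)) ∧
    S' = S ∪ C.image fun k => ((e k).2.1, (e k).1.2 + I.τ (baseArc (proj P) (e k)))

/-- The control states of the algorithm. -/
inductive State (P : ValidPartition I)
  /-- the loop body is entered with the set `S` of timed nodes -/
  | lower (S : Finset (TNode (AuxNode P)))
  /-- the lower bound formulation has been solved -/
  | solved (S : Finset (TNode (AuxNode P))) (z : Solution (AuxNode P) N K)
  /-- the trajectories have been extracted -/
  | routed (S : Finset (TNode (AuxNode P))) (z : Solution (AuxNode P) N K)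
      (Q : K → List (TArc (AuxNode P)))
  /-- the upper bound procedure has returned the solution `zbar` and the set `C` -/
  | bounded (S : Finset (TNode (AuxNode P))) (z : Solution (AuxNode P) N K)
      (Q : K → List (TArc (AuxNode P))) (zbar : Solution (AuxNode P) N K) (C : Finset K)
  /-- the algorithm has stopped with output `zbar` -/
  | stopped (zbar : Solution (AuxNode P) N K)

/-- One step of the algorithm. A configuration consists of the number of the current iteration of
the main loop and a control state. The relation is not functional, because the solutions of
the optimization problems and the arcs to be lengthened need not be unique. -/
inductive Step (P : ValidPartition I) : ℕ × State P → ℕ × State P → Prop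
  | solve {n S z} (h : OptimalGS P S z) : Step P (n, .lower S) (n, .solved S z)
  | route {n S z Q} (h : TrajectoriesOf P S z.x Q) : Step P (n, .solved S z) (n, .routed S z Q)
  | bound {n S z Q zbar C} (h : UpperBound P S z.x Q zbar C) :
      Step P (n, .routed S z Q) (n, .bounded S z Q zbar C)
  | finish {n S z Q zbar C} (h : costGT P zbar = costGS P S z) :
      Step P (n, .bounded S z Q zbar C) (n, .stopped zbar)
  | refine {n S z Q zbar C S'} (h : costGT P zbar ≠ costGS P S z) (h' : Refines P S Q C S') :
      Step P (n, .bounded S z Q zbar C) (n + 1, .lower S')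

/-- The initial configuration: the first iteration starts with the minimal set of timed nodes. -/
def start (P : ValidPartition I) : ℕ × State P := (1, .lower (initialNodes P))

end Formulations

end SNDRR

end

noncomputable section

set_option linter.unusedSectionVars false

namespace SNDRR

/-! ### Walks, movements, unit flows and trajectories -/

section Walks

variable {W : Type*}

/-! The proof compares all formulations through plans: for each commodity, the list of pairs (flat
arc, departure time) of its movements. With the least number of trucks, the cost of a family of
walks depends only on its plan (`TruckSystem.planCost_eq`), and any feasible solution costs at least
the plan of paths contained in it (`TruckSystem.planCost_le`). Merging departure times on the same
flat arc, or dropping movements, never raises the cost, because the ceiling is subadditive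
(`planCost_le_of_sublist_map`).

Lower bound. Rounding all times of walks in `G_T` down to times in `S` gives walks in `G_S`
(`Walk.exists_floor`). The tail copy in `G` is determined by the flat arc (`auxArcs_tail_unique`),
so movements that share a truck in `G_T` are rounded to the same time and still share it. Actual
transit times are unaffected, so the duration constraint survives. Hence the value of `G_S` bounds
`G_T` from below (`costGS_le_costGT`), and also `D_T`, whose paths lift to `G_T`
(`exists_GT_of_feasibleDT`). A stop with equal costs therefore certifies optimality
(`optimal_of_cost_eq`).

Every step is possible. Positive variable costs exclude superfluous movements from an optimal flow
of `G_S`, and storage arcs alone form no cycle, so the flow is a family of trajectories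
(`exists_trajectories`). The linear program is feasible because of the duration constraint. Adding
one common shift and taking floors preserves its constraints, and on average preserves absolute
differences (`exists_floor_sum_le`), so integral times suffice and a minimum exists
(`exists_optimalLP`).

Progress. If no commodity is selected, retiming splits no consolidated group, so the upper bound
does not exceed the lower bound (`nonempty_of_cost_ne`). Otherwise each lengthened arc contributes a
timed node outside `S` within the horizon (`Refines.card_lt`). There are `|V| * (T + 1)` timed nodes
and more than `|V|` initial ones, which leaves at most `|V| * T` iterations (`Iterate.le`). -/

@[simp] theorem tail_inl (e : TPair W) : tail (Sum.inl e) = e.1 := rfl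
@[simp] theorem tail_inr (e : TPair W) : tail (Sum.inr e) = e.1 := rfl
@[simp] theorem head_inl (e : TPair W) : head (Sum.inl e) = e.2 := rfl
@[simp] theorem head_inr (e : TPair W) : head (Sum.inr e) = e.2 := rfl

@[simp] theorem moves_nil : moves ([] : List (TArc W)) = [] := rfl
@[simp] theorem moves_inl (e : TPair W) (L : List (TArc W)) :
    moves (Sum.inl e :: L) = e :: moves L := rfl
@[simp] theorem moves_inr (e : TPair W) (L : List (TArc W)) :
    moves (Sum.inr e :: L) = moves L := rfl
@[simp] theorem moves_append (L L' : List (TArc W)) : moves (L ++ L') = moves L ++ moves L' :=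
  List.filterMap_append

theorem mem_moves {L : List (TArc W)} {e : TPair W} : e ∈ moves L ↔ Sum.inl e ∈ L := by
  simp [moves, List.mem_filterMap]

@[simp] theorem Network.inl_mem_arcs {net : Network W} {e : TPair W} :
    Sum.inl e ∈ net.arcs ↔ e ∈ net.move := by
  simp [Network.arcs]

@[simp] theorem Network.inr_mem_arcs {net : Network W} {e : TPair W} :
    Sum.inr e ∈ net.arcs ↔ e ∈ net.hold := by
  simp [Network.arcs]

/-- `L` is the list of arcs of a walk from `p` to `q`. -/
def Walk : TNode W → TNode W → List (TArc W) → Prop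
  | p, q, [] => p = q
  | p, q, e :: L => tail e = p ∧ Walk (head e) q L

theorem Walk.append {p q r : TNode W} {L L' : List (TArc W)} (h : Walk p q L)
    (h' : Walk q r L') : Walk p r (L ++ L') := by
  induction L generalizing p with
  | nil => obtain rfl : p = q := h; exact h'
  | cons e L ih => exact ⟨h.1, ih h.2⟩

theorem Walk.right_of_append {p q : TNode W} {L L' : List (TArc W)} (h : Walk p q (L ++ L')) :
    ∃ r, Walk r q L' := by
  induction L generalizing p with
  | nil => exact ⟨p, h⟩
  | cons e L ih => exact ih h.2

/-- Both lists are the sequence of visited timed nodes. Counting a node in both gives flow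
conservation for the incidence vector. -/
theorem Walk.cons_map_head {p q : TNode W} {L : List (TArc W)} (h : Walk p q L) :
    p :: L.map head = L.map tail ++ [q] := by
  induction L generalizing p with
  | nil => obtain rfl : p = q := h; rfl
  | cons e L ih => simp [← h.1, ih h.2]

theorem Walk.isChain {p q : TNode W} {L : List (TArc W)} (h : Walk p q L) :
    L.IsChain (fun e e' => head e = tail e') := by
  induction L generalizing p with
  | nil => exact List.IsChain.nil
  | cons e L ih =>
    cases L with
    | nil => exact List.IsChain.singleton _
    | cons e' L => exact List.IsChain.cons_cons h.2.1.symm (ih h.2)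

theorem Walk.getLast? {p q : TNode W} {L : List (TArc W)} (h : Walk p q L) (hL : L ≠ []) :
    L.getLast?.map head = some q := by
  induction L generalizing p with
  | nil => exact absurd rfl hL
  | cons e L ih =>
    cases L with
    | nil => simpa [Walk] using h.2
    | cons e' L => simpa [List.getLast?_cons_cons] using ih h.2 (by simp)

theorem Walk.isTrajectory {net : Network W} {p q : TNode W} {L : List (TArc W)}
    (h : Walk p q L) (hpq : p ≠ q) (hL : ∀ e ∈ L, e ∈ net.arcs)
    (hn : (L.map tail ++ [q]).Nodup) : IsTrajectory net p q L := by
  have hne : L ≠ [] := by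
    rintro rfl
    exact hpq h
  refine ⟨hL, h.isChain, ?_, h.getLast? hne, hn⟩
  cases L with
  | nil => exact absurd rfl hne
  | cons e L => simpa using h.1

theorem IsTrajectory.walk {net : Network W} {p q : TNode W} {L : List (TArc W)}
    (h : IsTrajectory net p q L) : Walk p q L := by
  obtain ⟨-, hc, hh, hl, -⟩ := h
  induction L generalizing p with
  | nil => simp at hh
  | cons e L ih =>
    refine ⟨by simpa using hh, ?_⟩
    cases L with
    | nil => simpa [Walk] using hl
    | cons e' L =>
      rw [List.isChain_cons_cons] at hc
      exact ih hc.2 (by simpa using hc.1.symm) (by simpa [List.getLast?_cons_cons] using hl)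

theorem IsTrajectory.nodup {net : Network W} {p q : TNode W} {L : List (TArc W)}
    (h : IsTrajectory net p q L) : L.Nodup :=
  List.Nodup.of_map _ (List.Nodup.of_append_left h.2.2.2.2)

/-- Every walk contains a node-simple walk. -/
theorem Walk.exists_simple {p q : TNode W} {L : List (TArc W)} (h : Walk p q L) :
    ∃ L', L'.Sublist L ∧ Walk p q L' ∧ (L'.map tail ++ [q]).Nodup := by
  induction L generalizing p with
  | nil => exact ⟨[], List.Sublist.refl _, h, by simp⟩
  | cons e L ih =>
    obtain ⟨L', hs, hw, hn⟩ := ih h.2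
    -- If the simple walk found so far revisits `p`, everything before that visit is cut off.
    by_cases h1 : p ∈ L'.map tail
    · obtain ⟨e', he', rfl⟩ := List.mem_map.1 h1
      obtain ⟨A, B, rfl⟩ := List.append_of_mem he'
      obtain ⟨r, hr⟩ := hw.right_of_append
      refine ⟨e' :: B, ((List.sublist_append_right A _).trans hs).trans (List.sublist_cons_self _ _),
        ⟨rfl, hr.2⟩, ?_⟩
      rw [List.map_append, List.append_assoc] at hn
      exact List.Nodup.of_append_right hn
    · by_cases h2 : p = q
      · exact ⟨[], List.nil_sublist _, h2, by simp⟩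
      · refine ⟨e :: L', hs.cons_cons e, ⟨h.1, hw⟩, ?_⟩
        simp only [List.map_cons, List.cons_append, List.nodup_cons]
        refine ⟨?_, hn⟩
        simp [h.1, h2] at h1 ⊢
        exact h1

/-- A walk that always moves forward in time is node-simple. -/
theorem Walk.nodup_of_time {p q : TNode W} {L : List (TArc W)} (h : Walk p q L)
    (ht : ∀ e ∈ L, (tail e).2 < (head e).2) :
    (L.map tail ++ [q]).Nodup ∧ ∀ r ∈ L.map tail ++ [q], p.2 ≤ r.2 := by
  induction L generalizing p with
  | nil => obtain rfl : p = q := h; simp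
  | cons e L ih =>
    obtain ⟨hn, hr⟩ := ih h.2 fun e' he' => ht e' (List.mem_cons_of_mem _ he')
    have h0 := ht e List.mem_cons_self
    have h1 := h.1
    subst h1
    refine ⟨?_, ?_⟩
    · simp only [List.map_cons, List.cons_append, List.nodup_cons]
      refine ⟨fun hm => ?_, hn⟩
      have := hr _ hm
      omega
    · intro r hm
      simp only [List.map_cons, List.cons_append, List.mem_cons] at hm
      rcases hm with rfl | hm
      · exact le_rfl
      · have := hr r hm
        omega

theorem Walk.forall_tail_fst {p q : TNode W} {L : List (TArc W)} {s : Set W} (h : Walk p q L)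
    (hp : p.1 ∈ s) (hs : ∀ e ∈ L, (tail e).1 ∈ s → (head e).1 ∈ s) :
    ∀ e ∈ L, (tail e).1 ∈ s := by
  induction L generalizing p with
  | nil => simp
  | cons e L ih =>
    have h0 : (tail e).1 ∈ s := by rw [h.1]; exact hp
    intro e' he'
    rcases List.mem_cons.1 he' with rfl | he'
    · exact h0
    · exact ih h.2 (hs e List.mem_cons_self h0) (fun e he => hs e (List.mem_cons_of_mem _ he)) e' he'

/-- The arc obtained by applying a map to the flat nodes. -/
def mapArc {W' : Type*} (φ : W → W') (e : TArc W) : TArc W' :=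
  Sum.map (fun e => ((φ e.1.1, e.1.2), (φ e.2.1, e.2.2)))
    (fun e => ((φ e.1.1, e.1.2), (φ e.2.1, e.2.2))) e

theorem tail_mapArc {W' : Type*} (φ : W → W') (e : TArc W) :
    tail (mapArc φ e) = (φ (tail e).1, (tail e).2) := by
  cases e <;> rfl

theorem head_mapArc {W' : Type*} (φ : W → W') (e : TArc W) :
    head (mapArc φ e) = (φ (head e).1, (head e).2) := by
  cases e <;> rfl

theorem Walk.map {W' : Type*} (φ : W → W') {p q : TNode W} {L : List (TArc W)} (h : Walk p q L) :
    Walk (φ p.1, p.2) (φ q.1, q.2) (L.map (mapArc φ)) := by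
  induction L generalizing p with
  | nil => obtain rfl : p = q := h; rfl
  | cons e L ih =>
    refine ⟨by rw [tail_mapArc, h.1], ?_⟩
    rw [head_mapArc]
    exact ih h.2

theorem moves_map {W' : Type*} (φ : W → W') (L : List (TArc W)) :
    moves (L.map (mapArc φ)) =
      (moves L).map fun e => ((φ e.1.1, e.1.2), (φ e.2.1, e.2.2)) := by
  induction L with
  | nil => rfl
  | cons e L ih => cases e <;> simp [mapArc, ← ih]

/-! ### Unit flows -/

open Classical in
/-- The incidence vector of a list of arcs. -/
def indicator (L : List (TArc W)) (e : TArc W) : ℕ := if e ∈ L then 1 else 0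

theorem indicator_eq_one {L : List (TArc W)} {e : TArc W} : indicator L e = 1 ↔ e ∈ L := by
  simp [indicator]

open Classical in
theorem sum_indicator (net : Network W) {L : List (TArc W)} (hL : L.Nodup)
    (hmem : ∀ e ∈ L, e ∈ net.arcs) (g : TArc W → TNode W) (p : TNode W) :
    ∑ e ∈ net.arcs.filter (fun e => g e = p), (indicator L e : ℤ) = ((L.map g).count p : ℤ) := by
  have h1 : ∑ e ∈ net.arcs.filter (fun e => g e = p), (indicator L e : ℤ) =
      ∑ e ∈ L.toFinset, if g e = p then (1 : ℤ) else 0 := by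
    simp only [indicator, Nat.cast_ite, Nat.cast_one, Nat.cast_zero]
    rw [← Finset.sum_filter, ← Finset.sum_filter]
    refine Finset.sum_congr ?_ fun _ _ => rfl
    ext e
    simp only [Finset.mem_filter, List.mem_toFinset]
    exact ⟨fun h => ⟨h.2, h.1.2⟩, fun h => ⟨⟨hmem e h.1, h.2⟩, h.1⟩⟩
  rw [h1, List.sum_toFinset _ hL]
  clear h1 hL hmem
  induction L with
  | nil => simp
  | cons e L ih =>
    simp only [List.map_cons, List.sum_cons, ih, List.count_cons, beq_iff_eq]
    split_ifs <;> push_cast <;> ring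

/-- The incidence vector of a walk without repeated arcs is a unit flow. -/
theorem Walk.isUnitFlow {net : Network W} {p q : TNode W} {L : List (TArc W)} (h : Walk p q L)
    (hpq : p ≠ q) (hL : L.Nodup) (hmem : ∀ e ∈ L, e ∈ net.arcs) :
    IsUnitFlow net p q (indicator L) := by
  classical
  refine ⟨fun e => ?_, fun e he => ?_, fun r _ => ?_⟩
  · by_cases he : e ∈ L <;> simp [indicator, he]
  · have : e ∉ L := fun h' => he (hmem e h')
    simp [indicator, this]
  · have h1 := sum_indicator net hL hmem tail r
    have h2 := sum_indicator net hL hmem head r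
    have h3 := congrArg (fun l => (l.count r : ℤ)) h.cons_map_head
    simp only [List.count_cons, List.count_append, List.count_nil, beq_iff_eq] at h3
    push_cast at h3
    rw [h1, h2]
    by_cases e1 : p = r
    · subst e1
      simp [hpq.symm] at h3 ⊢
      linarith
    · by_cases e2 : q = r
      · subst e2
        simp [hpq, Ne.symm hpq] at h3 ⊢
        linarith
      · simp [e1, e2, Ne.symm e1, Ne.symm e2] at h3 ⊢
        linarith

/-- The arcs of `net` join timed nodes of `net`. -/
def Network.Closed (net : Network W) : Prop :=
  ∀ e ∈ net.arcs, tail e ∈ net.nodes ∧ head e ∈ net.nodes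

/-- A unit flow contains a trajectory. -/
theorem IsUnitFlow.exists_trajectory {net : Network W} {p q : TNode W} {x : TArc W → ℕ}
    (h : IsUnitFlow net p q x) (hnet : net.Closed) (hq : q ∈ net.nodes)
    (hpq : p ≠ q) : ∃ L, IsTrajectory net p q L ∧ ∀ e ∈ L, x e = 1 := by
  classical
  obtain ⟨hb, hz, hc⟩ := h
  -- Cut argument: `R` holds at the nodes from which `q` is reachable along arcs carrying flow.
  let R : TNode W → Prop := fun r => ∃ L, Walk r q L ∧ ∀ e ∈ L, e ∈ net.arcs ∧ x e = 1
  have hR : R p := by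
    by_contra hp'
    have hqR : R q := ⟨[], rfl, by simp⟩
    have hstep : ∀ e ∈ net.arcs, x e ≠ 0 → R (head e) → R (tail e) := by
      rintro e he hx ⟨L, hL, hL'⟩
      refine ⟨e :: L, ⟨rfl, hL⟩, fun e' he' => ?_⟩
      rcases List.mem_cons.1 he' with rfl | h'
      · exact ⟨he, (hb _).resolve_left hx⟩
      · exact hL' e' h'
    set U := net.nodes.filter R with hU
    have hsum : ∑ r ∈ U, ((∑ e ∈ net.arcs.filter (fun e => tail e = r), (x e : ℤ)) -
        (∑ e ∈ net.arcs.filter (fun e => head e = r), (x e : ℤ))) = -1 := by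
      have h1 : ∀ r ∈ U, ((∑ e ∈ net.arcs.filter (fun e => tail e = r), (x e : ℤ)) -
        (∑ e ∈ net.arcs.filter (fun e => head e = r), (x e : ℤ))) = if r = q then -1 else 0 := by
        intro r hr
        have hr' := Finset.mem_filter.1 hr
        have := hc r hr'.1
        have hrp : r ≠ p := by
          rintro rfl
          exact hp' hr'.2
        rw [if_neg hrp] at this
        convert this using 1
      rw [Finset.sum_congr rfl h1, Finset.sum_ite_eq' U q,
        if_pos (Finset.mem_filter.2 ⟨hq, hqR⟩)]
    -- An arc with flow whose head is in `U` also has its tail in `U`, so the net outflow of `U` is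
    -- nonnegative. Without `p` in `U` it would be `-1`.
    have hle : ∑ r ∈ U, (∑ e ∈ net.arcs.filter (fun e => head e = r), (x e : ℤ)) ≤
        ∑ r ∈ U, (∑ e ∈ net.arcs.filter (fun e => tail e = r), (x e : ℤ)) := by
      simp only [Finset.sum_filter]
      rw [Finset.sum_comm, Finset.sum_comm (s := U)]
      refine Finset.sum_le_sum fun e he => ?_
      simp only [Finset.sum_ite_eq]
      by_cases h0 : x e = 0
      · simp [h0]
      · split_ifs with h1 h2
        · exact le_rfl
        · exact absurd (Finset.mem_filter.2
            ⟨(hnet e he).1, hstep e he h0 (Finset.mem_filter.1 h1).2⟩) h2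
        · positivity
        · exact le_rfl
    rw [Finset.sum_sub_distrib] at hsum
    omega
  obtain ⟨L, hL, hL'⟩ := hR
  obtain ⟨L', hs, hw, hn⟩ := hL.exists_simple
  exact ⟨L', hw.isTrajectory hpq (fun e he => (hL' e (hs.subset he)).1) hn,
    fun e he => (hL' e (hs.subset he)).2⟩

open Classical in
/-- Weighted sums over the movement arcs of a list of arcs without repetition. -/
theorem sum_move_indicator {R : Type*} [CommSemiring R] (net : Network W) {L : List (TArc W)}
    (hL : L.Nodup) (hmem : ∀ e ∈ L, e ∈ net.arcs) (h : TPair W → R) :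
    ∑ e ∈ net.move, h e * (indicator L (Sum.inl e) : R) = ((moves L).map h).sum := by
  have hn : (moves L).Nodup := by
    refine hL.filterMap ?_
    rintro (a | a) (b | b) c ha hb <;> simp_all
  rw [← List.sum_toFinset _ hn]
  have : (moves L).toFinset = net.move.filter fun e => Sum.inl e ∈ L := by
    ext e
    simp only [List.mem_toFinset, mem_moves, Finset.mem_filter]
    exact ⟨fun h => ⟨Network.inl_mem_arcs.1 (hmem _ h), h⟩, fun h => h.2⟩
  rw [this, Finset.sum_filter]
  refine Finset.sum_congr rfl fun e _ => ?_
  by_cases he : Sum.inl e ∈ L <;> simp [indicator, he]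

/-! ### Holding -/

/-- `q` can be reached from `p` by storage arcs of `net`. -/
def HoldReach (net : Network W) (p q : TNode W) : Prop :=
  ∃ L, Walk p q L ∧ moves L = [] ∧ ∀ e ∈ L, e ∈ net.arcs

theorem HoldReach.refl (net : Network W) (p : TNode W) : HoldReach net p p :=
  ⟨[], rfl, rfl, by simp⟩

theorem HoldReach.trans {net : Network W} {p q r : TNode W} (h : HoldReach net p q)
    (h' : HoldReach net q r) : HoldReach net p r := by
  obtain ⟨L, h1, h2, h3⟩ := h
  obtain ⟨L', h1', h2', h3'⟩ := h'
  refine ⟨L ++ L', h1.append h1', by simp [h2, h2'], fun e he => ?_⟩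
  rcases List.mem_append.1 he with he | he
  · exact h3 e he
  · exact h3' e he

theorem HoldReach.of_mem {net : Network W} {e : TPair W} (h : e ∈ net.hold) :
    HoldReach net e.1 e.2 :=
  ⟨[Sum.inr e], ⟨rfl, rfl⟩, rfl, by simpa using h⟩

/-- A sequence of movements that can be joined by storage arcs extends to a walk. -/
theorem exists_walk_of_moves {net : Network W} {n : ℕ} (m : Fin n → TPair W) {p q : TNode W}
    (hn : 0 < n) (hm : ∀ i, m i ∈ net.move) (hp : ∀ i, i.val = 0 → HoldReach net p (m i).1)
    (hstep : ∀ i j, j.val = i.val + 1 → HoldReach net (m i).2 (m j).1)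
    (hq : ∀ i, i.val + 1 = n → HoldReach net (m i).2 q) :
    ∃ L, Walk p q L ∧ moves L = List.ofFn m ∧ ∀ e ∈ L, e ∈ net.arcs := by
  induction n generalizing p with
  | zero => omega
  | succ n ih =>
    obtain ⟨L, h1, h2, h3⟩ := hp 0 rfl
    suffices ∃ L', Walk (m 0).2 q L' ∧ moves L' = List.ofFn (fun i : Fin n => m i.succ) ∧
        ∀ e ∈ L', e ∈ net.arcs by
      obtain ⟨L', h1', h2', h3'⟩ := this
      refine ⟨L ++ Sum.inl (m 0) :: L', h1.append ⟨rfl, h1'⟩, by simp [h2, h2', List.ofFn_succ],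
        fun e he => ?_⟩
      rcases List.mem_append.1 he with he | he
      · exact h3 e he
      · rcases List.mem_cons.1 he with rfl | he
        · simpa using hm 0
        · exact h3' e he
    rcases Nat.eq_zero_or_pos n with rfl | hn'
    · obtain ⟨L', h1', h2', h3'⟩ := hq 0 rfl
      exact ⟨L', h1', by simpa using h2', h3'⟩
    · refine ih (fun i => m i.succ) hn' (fun i => hm _) (fun i hi => hstep 0 i.succ ?_)
        (fun i j hij => hstep i.succ j.succ ?_) (fun i hi => hq i.succ ?_)
      · simp [hi]
      · simp [hij]
      · simp [hi]

/-- The movements of a walk whose storage arcs stay put and move forward in time. -/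
theorem Walk.moves_spec {p q : TNode W} {L : List (TArc W)} (h : Walk p q L)
    (hh : ∀ e, Sum.inr e ∈ L → e.2.1 = e.1.1 ∧ e.1.2 ≤ e.2.2) :
    (moves L = [] → p.1 = q.1 ∧ p.2 ≤ q.2) ∧
    (∀ (i : ℕ) (hi : i < (moves L).length), i = 0 →
      p.1 = (moves L)[i].1.1 ∧ p.2 ≤ (moves L)[i].1.2) ∧
    (∀ (i j : ℕ) (hi : i < (moves L).length) (hj : j < (moves L).length), j = i + 1 →
      (moves L)[i].2.1 = (moves L)[j].1.1 ∧ (moves L)[i].2.2 ≤ (moves L)[j].1.2) ∧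
    (∀ (i : ℕ) (hi : i < (moves L).length), i + 1 = (moves L).length →
      (moves L)[i].2.1 = q.1 ∧ (moves L)[i].2.2 ≤ q.2) := by
  induction L generalizing p with
  | nil => obtain rfl : p = q := h; simp
  | cons e L ih =>
    obtain ⟨h0, h1, h2, h3⟩ := ih h.2 fun e he => hh e (List.mem_cons_of_mem _ he)
    obtain ⟨rfl, -⟩ := h
    cases e with
    | inl m =>
      refine ⟨by simp, ?_, ?_, ?_⟩
      · rintro i hi rfl
        simp
      · rintro i j hi hj rfl
        cases i with
        | zero => exact h1 0 (by simpa using hj) rfl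
        | succ i => exact h2 i (i + 1) (by simpa using hi) (by simpa using hj) rfl
      · intro i hi hi'
        cases i with
        | zero =>
          have : moves L = [] := List.length_eq_zero_iff.1 (by simpa using hi'.symm)
          exact h0 this
        | succ i => exact h3 i (by simpa using hi) (by simpa using hi')
    | inr m =>
      obtain ⟨ha, hb⟩ := hh m List.mem_cons_self
      simp only [head_inr, tail_inr, moves_inr] at *
      refine ⟨fun hL => ?_, fun i hi hi0 => ?_, h2, h3⟩
      · have := h0 hL
        exact ⟨ha ▸ this.1, hb.trans this.2⟩
      · have := h1 i hi hi0
        exact ⟨ha ▸ this.1, hb.trans this.2⟩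

end Walks

/-- The excess of `x` over the path is a circulation made of storage arcs only. These move forward
in time, so a nonempty excess would have no latest arc. -/
theorem IsUnitFlow.mem_of_eq_one {W : Type*} {net : Network W} {p q : TNode W} {x : TArc W → ℕ}
    {L : List (TArc W)} (hx : IsUnitFlow net p q x) (hL : IsUnitFlow net p q (indicator L))
    (hLx : ∀ e ∈ L, x e = 1) (hm : ∀ e, x (Sum.inl e) = 1 → Sum.inl e ∈ L)
    (hhold : ∀ e ∈ net.hold, e.1.2 < e.2.2) (hnet : net.Closed) :
    ∀ e, x e = 1 → e ∈ L := by
  classical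
  by_contra hcon
  push Not at hcon
  obtain ⟨e₀, he₀, he₀'⟩ := hcon
  set U := net.arcs.filter fun e => x e = 1 ∧ e ∉ L with hU
  have hmemU : ∀ e, e ∈ U ↔ x e = 1 ∧ e ∉ L := by
    intro e
    simp only [hU, Finset.mem_filter, and_iff_right_iff_imp]
    rintro ⟨h1, -⟩
    by_contra h2
    rw [hx.2.1 e h2] at h1
    exact absurd h1 zero_ne_one
  obtain ⟨e, he, hmax⟩ := Finset.exists_max_image U (fun e => (head e).2) ⟨e₀, (hmemU _).2 ⟨he₀, he₀'⟩⟩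
  have heA : e ∈ net.arcs := (Finset.mem_filter.1 he).1
  have hle : ∀ e, indicator L e ≤ x e := by
    intro e
    by_cases h : e ∈ L
    · rw [hLx e h, indicator_eq_one.2 h]
    · simp [indicator, h]
  have h1 := hx.2.2 (head e) (hnet e heA).2
  have h2 := hL.2.2 (head e) (hnet e heA).2
  -- Both flows have the same balance at the head of `e`. More inflow in `x` forces more outflow,
  -- hence a later excess arc.
  have h3 : ∑ e' ∈ net.arcs.filter (fun e' => head e' = head e), (indicator L e' : ℤ) <
      ∑ e' ∈ net.arcs.filter (fun e' => head e' = head e), (x e' : ℤ) := by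
    refine Finset.sum_lt_sum (fun e' _ => by exact_mod_cast hle e') ⟨e, by simp [heA], ?_⟩
    have := (hmemU e).1 he
    simp [indicator, this.1, this.2]
  obtain ⟨e', he', hlt⟩ : ∃ e' ∈ net.arcs.filter (fun e' => tail e' = head e),
      (indicator L e' : ℤ) < (x e' : ℤ) := by
    apply Finset.exists_lt_of_sum_lt
    linarith
  have he'U : e' ∈ U := by
    rw [hmemU]
    have hlt' : indicator L e' < x e' := by exact_mod_cast hlt
    rcases hx.1 e' with h | h
    · omega
    · refine ⟨h, fun h' => ?_⟩
      rw [indicator_eq_one.2 h', h] at hlt'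
      exact lt_irrefl _ hlt'
  have h4 := hmax e' he'U
  obtain ⟨heA', ht⟩ := Finset.mem_filter.1 he'
  rcases e' with m | m
  · exact ((hmemU _).1 he'U).2 (hm m ((hmemU _).1 he'U).1)
  · have := hhold m (Network.inr_mem_arcs.1 heA')
    rw [← ht] at h4
    simp at h4
    omega

/-! ### Plans: costs in terms of flat arcs and departure times -/

section Plans

variable {N K : Type*} [Fintype K]

/-- The flat arc and the departure time of a movement. -/
def key {W : Type*} (π : W → N) (e : TPair W) : (N × N) × ℕ := (baseArc π e, e.1.2)

/-- The movements of each commodity, given by flat arc and departure time. -/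
def planOf {W : Type*} (π : W → N) (L : K → List (TArc W)) (k : K) : List ((N × N) × ℕ) :=
  (moves (L k)).map (key π)

open Classical in
/-- The total demand transported by a movement of a plan. -/
def planLoad (I : Instance N K) (κs : K → List ((N × N) × ℕ)) (κ : (N × N) × ℕ) : ℝ :=
  ∑ k, I.q k * ((κs k).map fun κ' => if κ' = κ then (1 : ℝ) else 0).sum

/-- The least number of trucks for a movement of a plan. -/
def planTrucks (I : Instance N K) (κs : K → List ((N × N) × ℕ)) (κ : (N × N) × ℕ) : ℕ :=
  ⌈planLoad I κs κ / (I.u κ.1 : ℝ)⌉₊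

/-- The variable cost of a plan. -/
def planVar (I : Instance N K) (κs : K → List ((N × N) × ℕ)) : ℝ :=
  ∑ k, I.q k * ((κs k).map fun κ => I.c k κ.1).sum

open Classical in
/-- The movements of a plan. -/
def planKeys (κs : K → List ((N × N) × ℕ)) : Finset ((N × N) × ℕ) :=
  Finset.univ.biUnion fun k => (κs k).toFinset

/-- The cost of a plan with the least number of trucks. -/
def planCost (I : Instance N K) (κs : K → List ((N × N) × ℕ)) : ℝ :=
  ∑ κ ∈ planKeys κs, I.f κ.1 * (planTrucks I κs κ : ℝ) + planVar I κs

theorem mem_planKeys {κs : K → List ((N × N) × ℕ)} {κ : (N × N) × ℕ} :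
    κ ∈ planKeys κs ↔ ∃ k, κ ∈ κs k := by
  simp [planKeys]

theorem planLoad_eq_zero (I : Instance N K) {κs : K → List ((N × N) × ℕ)} {κ : (N × N) × ℕ}
    (h : κ ∉ planKeys κs) : planLoad I κs κ = 0 := by
  refine Finset.sum_eq_zero fun k _ => mul_eq_zero_of_right _ (List.sum_eq_zero fun a ha => ?_)
  obtain ⟨κ', hκ', rfl⟩ := List.mem_map.1 ha
  rw [if_neg]
  rintro rfl
  exact h (mem_planKeys.2 ⟨k, hκ'⟩)

/-- Consolidating movements or leaving out movements does not increase the cost of a plan. -/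
theorem planCost_le_of_sublist_map (I : Instance N K) {κs κs' : K → List ((N × N) × ℕ)}
    (g : (N × N) × ℕ → (N × N) × ℕ) (hg : ∀ κ, (g κ).1 = κ.1)
    (h : ∀ k, (κs' k).Sublist ((κs k).map g)) (harc : ∀ k, ∀ κ ∈ κs k, κ.1 ∈ I.arcs) :
    planCost I κs' ≤ planCost I κs := by
  classical
  -- The load at `κ'` comes only from the old movements in its fiber under `g`.
  have hload : ∀ κ', planLoad I κs' κ' ≤
      ∑ κ ∈ (planKeys κs).filter (fun κ => g κ = κ'), planLoad I κs κ := by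
    intro κ'
    unfold planLoad
    rw [Finset.sum_comm]
    refine Finset.sum_le_sum fun k _ => ?_
    rw [← Finset.mul_sum]
    refine mul_le_mul_of_nonneg_left ?_ (I.q_pos k).le
    have h1 : ((κs' k).map fun κ'' => if κ'' = κ' then (1 : ℝ) else 0).sum ≤
        (((κs k).map g).map fun κ'' => if κ'' = κ' then (1 : ℝ) else 0).sum := by
      refine ((h k).map _).sum_le_sum fun a ha => ?_
      obtain ⟨κ', -, rfl⟩ := List.mem_map.1 ha
      positivity
    refine h1.trans (le_of_eq ?_)
    have hk : ∀ κ ∈ κs k, κ ∈ planKeys κs := fun κ hκ => mem_planKeys.2 ⟨k, hκ⟩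
    generalize planKeys κs = U at hk
    generalize κs k = l at hk
    induction l with
    | nil => simp
    | cons κ l ih =>
      have := ih fun κ hκ => hk κ (List.mem_cons_of_mem _ hκ)
      simp only [List.map_cons, List.sum_cons, Finset.sum_add_distrib, this]
      congr 1
      have h0 := hk κ List.mem_cons_self
      simp [Finset.sum_ite_eq, h0]
  -- All members of a fiber have the same flat arc, hence the same capacity, and the ceiling of a
  -- sum is at most the sum of the ceilings.
  have htr : ∀ κ', planTrucks I κs' κ' ≤
      ∑ κ ∈ (planKeys κs).filter (fun κ => g κ = κ'), planTrucks I κs κ := by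
    intro κ'
    refine Nat.ceil_le.2 ?_
    push_cast
    calc planLoad I κs' κ' / (I.u κ'.1 : ℝ)
        ≤ (∑ κ ∈ (planKeys κs).filter (fun κ => g κ = κ'), planLoad I κs κ) / (I.u κ'.1 : ℝ) :=
          div_le_div_of_nonneg_right (hload κ') (Nat.cast_nonneg _)
      _ = ∑ κ ∈ (planKeys κs).filter (fun κ => g κ = κ'), planLoad I κs κ / (I.u κ.1 : ℝ) := by
          rw [Finset.sum_div]
          refine Finset.sum_congr rfl fun κ hκ => ?_
          rw [← (Finset.mem_filter.1 hκ).2, hg]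
      _ ≤ _ := Finset.sum_le_sum fun κ _ => Nat.le_ceil _
  refine add_le_add ?_ ?_
  · calc ∑ κ' ∈ planKeys κs', I.f κ'.1 * (planTrucks I κs' κ' : ℝ)
        ≤ ∑ κ' ∈ (planKeys κs).image g, I.f κ'.1 *
          ∑ κ ∈ (planKeys κs).filter (fun κ => g κ = κ'), (planTrucks I κs κ : ℝ) := by
          have hsub : planKeys κs' ⊆ (planKeys κs).image g := by
            intro κ' hκ'
            obtain ⟨k, hk⟩ := mem_planKeys.1 hκ'
            obtain ⟨κ, hκ, rfl⟩ := List.mem_map.1 ((h k).subset hk)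
            exact Finset.mem_image_of_mem _ (mem_planKeys.2 ⟨k, hκ⟩)
          have hpos : ∀ κ' ∈ (planKeys κs).image g, 0 ≤ I.f κ'.1 := by
            intro κ' hκ'
            obtain ⟨κ, hκ, rfl⟩ := Finset.mem_image.1 hκ'
            obtain ⟨k, hk⟩ := mem_planKeys.1 hκ
            rw [hg]
            exact (I.f_pos _ (harc k κ hk)).le
          refine (Finset.sum_le_sum_of_subset_of_nonneg hsub fun κ' hκ' _ =>
            mul_nonneg (hpos κ' hκ') (Nat.cast_nonneg _)).trans
            (Finset.sum_le_sum fun κ' hκ' => mul_le_mul_of_nonneg_left ?_ (hpos κ' hκ'))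
          exact_mod_cast htr κ'
      _ = ∑ κ' ∈ (planKeys κs).image g,
          ∑ κ ∈ (planKeys κs).filter (fun κ => g κ = κ'), I.f κ.1 * (planTrucks I κs κ : ℝ) := by
          refine Finset.sum_congr rfl fun κ' _ => ?_
          rw [Finset.mul_sum]
          refine Finset.sum_congr rfl fun κ hκ => ?_
          rw [← (Finset.mem_filter.1 hκ).2, hg]
      _ = _ := Finset.sum_fiberwise_of_maps_to (fun κ hκ => Finset.mem_image_of_mem _ hκ) _
  · refine Finset.sum_le_sum fun k _ => mul_le_mul_of_nonneg_left ?_ (I.q_pos k).le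
    refine (((h k).map _).sum_le_sum fun a ha => ?_).trans (le_of_eq ?_)
    · simp only [List.mem_map] at ha
      obtain ⟨_, ⟨κ, hκ, rfl⟩, rfl⟩ := ha
      rw [hg]
      exact (I.c_pos k _ (harc k κ hκ)).le
    · rw [List.map_map]
      congr 2
      funext κ
      simp [hg]

/-- The trucks are scheduled on timed arcs that represent the pairs of a flat arc and a departure
time that occur among the movement arcs of `net`. -/
structure TruckSystem {W : Type*} (I : Instance N K) (π : W → N) (net : Network W)
    (A : Finset (TPair N)) (copies : TPair N → Finset (TPair W)) : Prop where
  mem_copies : ∀ a ∈ A, ∀ e, e ∈ copies a ↔ e ∈ net.move ∧ key π e = key id a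
  inj : Set.InjOn (key id) (A : Set (TPair N))
  exists_rep : ∀ e ∈ net.move, ∃ a ∈ A, key id a = key π e
  base_mem : ∀ a ∈ A, baseArc id a ∈ I.arcs

namespace TruckSystem

variable {W : Type*} {I : Instance N K} {π : W → N} {net : Network W} {A : Finset (TPair N)}
  {copies : TPair N → Finset (TPair W)}

theorem baseArc_mem (h : TruckSystem I π net A copies) {e : TPair W} (he : e ∈ net.move) :
    baseArc π e ∈ I.arcs := by
  obtain ⟨a, ha, hae⟩ := h.exists_rep e he
  have := h.base_mem a ha
  have hb : baseArc id a = baseArc π e := congrArg Prod.fst hae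
  rwa [hb] at this

theorem load_indicator (h : TruckSystem I π net A copies) {L : K → List (TArc W)}
    (hn : ∀ k, (L k).Nodup) (hL : ∀ k, ∀ e ∈ L k, e ∈ net.arcs) {a : TPair N} (ha : a ∈ A) :
    load I (copies a) (fun k => indicator (L k)) = planLoad I (planOf π L) (key id a) := by
  classical
  refine Finset.sum_congr rfl fun k _ => ?_
  have hc : copies a = net.move.filter fun e => key π e = key id a := by
    ext e
    rw [h.mem_copies a ha, Finset.mem_filter]
  rw [hc, ← Finset.mul_sum, Finset.sum_filter]
  congr 1
  rw [planOf, List.map_map, ← sum_move_indicator net (hn k) (hL k)]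
  refine Finset.sum_congr rfl fun e _ => ?_
  simp

theorem variableCost_indicator {L : K → List (TArc W)}
    (hn : ∀ k, (L k).Nodup) (hL : ∀ k, ∀ e ∈ L k, e ∈ net.arcs) :
    variableCost I π net.move (fun k => indicator (L k)) = planVar I (planOf π L) := by
  refine Finset.sum_congr rfl fun k _ => ?_
  rw [planOf, List.map_map]
  have := sum_move_indicator net (hn k) (hL k) (fun e => I.c k (baseArc π e))
  simp only [mul_right_comm _ (I.q k)]
  rw [← Finset.sum_mul, this, mul_comm]
  rfl

theorem planOf_arc_mem (h : TruckSystem I π net A copies) {L : K → List (TArc W)}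
    (hL : ∀ k, ∀ e ∈ L k, e ∈ net.arcs) (k : K) : ∀ κ ∈ planOf π L k, κ.1 ∈ I.arcs := by
  intro κ hκ
  obtain ⟨e, he, rfl⟩ := List.mem_map.1 hκ
  exact h.baseArc_mem (Network.inl_mem_arcs.1 (hL k _ (mem_moves.1 he)))

/-- Each movement of the plan has a unique representative in `A`, and the remaining members of `A`
carry no load and need no truck. -/
theorem sum_trucks (h : TruckSystem I π net A copies) {L : K → List (TArc W)}
    (hL : ∀ k, ∀ e ∈ L k, e ∈ net.arcs) :
    ∑ a ∈ A, I.f (baseArc id a) * (planTrucks I (planOf π L) (key id a) : ℝ) =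
      ∑ κ ∈ planKeys (planOf π L), I.f κ.1 * (planTrucks I (planOf π L) κ : ℝ) := by
  classical
  refine (Finset.sum_image (f := fun κ => I.f κ.1 * (planTrucks I (planOf π L) κ : ℝ))
    h.inj).symm.trans (Eq.symm ?_)
  refine Finset.sum_subset ?_ fun κ _ hκ => ?_
  · intro κ hκ
    obtain ⟨k, hk⟩ := mem_planKeys.1 hκ
    obtain ⟨e, he, rfl⟩ := List.mem_map.1 hk
    obtain ⟨a, ha, hae⟩ := h.exists_rep e (Network.inl_mem_arcs.1 (hL k _ (mem_moves.1 he)))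
    exact Finset.mem_image.2 ⟨a, ha, hae⟩
  · rw [planTrucks, planLoad_eq_zero I hκ]
    simp

theorem planCost_eq (h : TruckSystem I π net A copies) {L : K → List (TArc W)}
    (hn : ∀ k, (L k).Nodup) (hL : ∀ k, ∀ e ∈ L k, e ∈ net.arcs) {y : TPair N → ℕ}
    (hy : ∀ a ∈ A, y a = planTrucks I (planOf π L) (key id a)) :
    fixedCost I A y + variableCost I π net.move (fun k => indicator (L k)) =
      planCost I (planOf π L) := by
  rw [variableCost_indicator hn hL, planCost, ← h.sum_trucks hL]
  congr 1
  exact Finset.sum_congr rfl fun a ha => by rw [hy a ha]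

theorem load_le (h : TruckSystem I π net A copies) {L : K → List (TArc W)}
    (hn : ∀ k, (L k).Nodup) (hL : ∀ k, ∀ e ∈ L k, e ∈ net.arcs) {y : TPair N → ℕ} {a : TPair N}
    (ha : a ∈ A) (hy : y a = planTrucks I (planOf π L) (key id a)) :
    load I (copies a) (fun k => indicator (L k)) ≤ (I.u (baseArc id a) : ℝ) * (y a : ℝ) := by
  rw [h.load_indicator hn hL ha, hy]
  have hu : (0 : ℝ) < I.u (baseArc id a) := by exact_mod_cast I.u_pos _ (h.base_mem a ha)
  rw [mul_comm, ← div_le_iff₀ hu]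
  exact Nat.le_ceil _

theorem load_mono {s : Finset (TPair W)} {x x' : K → TArc W → ℕ} (h : ∀ k e, x k e ≤ x' k e) :
    load I s x ≤ load I s x' :=
  Finset.sum_le_sum fun k _ => Finset.sum_le_sum fun e _ =>
    mul_le_mul_of_nonneg_left (by exact_mod_cast h k _) (I.q_pos k).le

theorem variableCost_mono (h : TruckSystem I π net A copies) {x x' : K → TArc W → ℕ}
    (hx : ∀ k e, x k e ≤ x' k e) :
    variableCost I π net.move x ≤ variableCost I π net.move x' :=
  Finset.sum_le_sum fun k _ => Finset.sum_le_sum fun e he =>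
    mul_le_mul_of_nonneg_left (by exact_mod_cast hx k _)
      (mul_nonneg (I.c_pos k _ (h.baseArc_mem he)).le (I.q_pos k).le)

/-- Every movement arc has a positive variable cost per commodity, so a single superfluous movement
would make `x'` strictly dearer. This excludes movements off the path in an optimal flow. -/
theorem eq_of_variableCost_le (h : TruckSystem I π net A copies) {x x' : K → TArc W → ℕ}
    (hx : ∀ k e, x k e ≤ x' k e)
    (hc : variableCost I π net.move x' ≤ variableCost I π net.move x) {k : K} {e : TPair W}
    (he : e ∈ net.move) : x' k (Sum.inl e) = x k (Sum.inl e) := by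
  by_contra hne
  refine absurd hc (not_le.2 ?_)
  have hle : ∀ k, ∀ e ∈ net.move, I.c k (baseArc π e) * I.q k * (x k (Sum.inl e) : ℝ) ≤
      I.c k (baseArc π e) * I.q k * (x' k (Sum.inl e) : ℝ) := fun k e he =>
    mul_le_mul_of_nonneg_left (by exact_mod_cast hx k _)
      (mul_nonneg (I.c_pos k _ (h.baseArc_mem he)).le (I.q_pos k).le)
  refine Finset.sum_lt_sum (fun k _ => Finset.sum_le_sum (hle k)) ⟨k, Finset.mem_univ _, ?_⟩
  refine Finset.sum_lt_sum (hle k) ⟨e, he, ?_⟩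
  refine mul_lt_mul_of_pos_left ?_ (mul_pos (I.c_pos k _ (h.baseArc_mem he)) (I.q_pos k))
  exact_mod_cast lt_of_le_of_ne (hx k _) (Ne.symm hne)

/-- Every feasible solution costs at least as much as the plan of a family of paths in it. -/
theorem planCost_le (h : TruckSystem I π net A copies) {L : K → List (TArc W)}
    (hn : ∀ k, (L k).Nodup) (hL : ∀ k, ∀ e ∈ L k, e ∈ net.arcs) {x : K → TArc W → ℕ}
    (hx : ∀ k, ∀ e ∈ L k, x k e = 1) {y : TPair N → ℕ}
    (hy : ∀ a ∈ A, load I (copies a) x ≤ (I.u (baseArc id a) : ℝ) * (y a : ℝ)) :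
    planCost I (planOf π L) ≤ fixedCost I A y + variableCost I π net.move x := by
  have hle : ∀ k e, indicator (L k) e ≤ x k e := by
    intro k e
    by_cases he : e ∈ L k
    · rw [hx k e he, indicator_eq_one.2 he]
    · simp [indicator, he]
  rw [← h.planCost_eq hn hL (y := fun a => planTrucks I (planOf π L) (key id a)) fun _ _ => rfl]
  refine add_le_add (Finset.sum_le_sum fun a ha => ?_) (h.variableCost_mono hle)
  refine mul_le_mul_of_nonneg_left ?_ (I.f_pos _ (h.base_mem a ha)).le
  have hu : (0 : ℝ) < I.u (baseArc id a) := by exact_mod_cast I.u_pos _ (h.base_mem a ha)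
  have := (load_mono hle).trans (hy a ha)
  rw [h.load_indicator hn hL ha] at this
  have h2 : planTrucks I (planOf π L) (key id a) ≤ y a := by
    refine Nat.ceil_le.2 ?_
    rw [div_le_iff₀ (by exact hu), mul_comm]
    exact this
  exact_mod_cast h2

end TruckSystem

end Plans

/-! ### Full and partial networks and their designated parts -/

section Nets

variable {W : Type*}

theorem mem_restrict_move {net : Network W} {ns : Finset W} {as : Finset (W × W)} {e : TPair W} :
    e ∈ (net.restrict ns as).move ↔ e ∈ net.move ∧ (e.1.1, e.2.1) ∈ as := by
  simp [Network.restrict]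

theorem mem_restrict_hold {net : Network W} {ns : Finset W} {as : Finset (W × W)} {e : TPair W} :
    e ∈ (net.restrict ns as).hold ↔ e ∈ net.hold ∧ e.1.1 ∈ ns := by
  simp [Network.restrict]

theorem mem_restrict_nodes {net : Network W} {ns : Finset W} {as : Finset (W × W)} {p : TNode W} :
    p ∈ (net.restrict ns as).nodes ↔ p ∈ net.nodes ∧ p.1 ∈ ns := by
  simp [Network.restrict]

theorem restrict_arcs_subset {net : Network W} {ns : Finset W} {as : Finset (W × W)} {e : TArc W}
    (he : e ∈ (net.restrict ns as).arcs) : e ∈ net.arcs := by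
  cases e with
  | inl e => exact Network.inl_mem_arcs.2 (mem_restrict_move.1 (Network.inl_mem_arcs.1 he)).1
  | inr e => exact Network.inr_mem_arcs.2 (mem_restrict_hold.1 (Network.inr_mem_arcs.1 he)).1

theorem Network.Closed.restrict {net : Network W} (h : net.Closed)
    (hh : ∀ e ∈ net.hold, e.2.1 = e.1.1) {ns : Finset W} {as : Finset (W × W)}
    (has : ∀ a ∈ as, a.1 ∈ ns ∧ a.2 ∈ ns) : (net.restrict ns as).Closed := by
  intro e he
  have h0 := h e (restrict_arcs_subset he)
  cases e with
  | inl e =>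
    have := has _ (mem_restrict_move.1 (Network.inl_mem_arcs.1 he)).2
    exact ⟨mem_restrict_nodes.2 ⟨h0.1, this.1⟩, mem_restrict_nodes.2 ⟨h0.2, this.2⟩⟩
  | inr e =>
    have := mem_restrict_hold.1 (Network.inr_mem_arcs.1 he)
    refine ⟨mem_restrict_nodes.2 ⟨h0.1, this.2⟩, mem_restrict_nodes.2 ⟨h0.2, ?_⟩⟩
    rw [head_inr, hh e this.1]
    exact this.2

/-- A walk that starts over `ns` and whose movements are over `as` lies over `(ns, as)`. -/
theorem Walk.mem_restrict {net : Network W} (hh : ∀ e ∈ net.hold, e.2.1 = e.1.1)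
    {ns : Finset W} {as : Finset (W × W)} (has : ∀ a ∈ as, a.1 ∈ ns ∧ a.2 ∈ ns)
    {p q : TNode W} {L : List (TArc W)} (h : Walk p q L) (hL : ∀ e ∈ L, e ∈ net.arcs)
    (hm : ∀ e ∈ moves L, (e.1.1, e.2.1) ∈ as) (hp : p.1 ∈ ns) :
    ∀ e ∈ L, e ∈ (net.restrict ns as).arcs := by
  have hns := h.forall_tail_fst (s := {v | v ∈ ns}) hp (by
    rintro (e | e) he h0
    · exact (has _ (hm e (mem_moves.2 he))).2
    · have := hh e (Network.inr_mem_arcs.1 (hL _ he))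
      simp only [tail_inr, head_inr, Set.mem_ofPred_eq] at h0 ⊢
      rwa [this])
  rintro (e | e) he
  · exact Network.inl_mem_arcs.2 (mem_restrict_move.2
      ⟨Network.inl_mem_arcs.1 (hL _ he), hm e (mem_moves.2 he)⟩)
  · exact Network.inr_mem_arcs.2 (mem_restrict_hold.2
      ⟨Network.inr_mem_arcs.1 (hL _ he), hns _ he⟩)

section Full

variable [Fintype W] {arcs : Finset (W × W)} {τ : W × W → ℕ} {T : ℕ}

theorem mem_fullNetwork_move {e : TPair W} : e ∈ (fullNetwork arcs τ T).move ↔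
    e.1.2 ≤ T ∧ e.2.2 ≤ T ∧ (e.1.1, e.2.1) ∈ arcs ∧ e.2.2 = e.1.2 + τ (e.1.1, e.2.1) := by
  simp [fullNetwork, and_assoc]

theorem mem_fullNetwork_hold {e : TPair W} : e ∈ (fullNetwork arcs τ T).hold ↔
    e.1.2 ≤ T ∧ e.2.2 ≤ T ∧ e.2.1 = e.1.1 ∧ e.2.2 = e.1.2 + 1 := by
  simp [fullNetwork, and_assoc]

theorem mem_fullNetwork_nodes {p : TNode W} : p ∈ (fullNetwork arcs τ T).nodes ↔ p.2 ≤ T := by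
  simp [fullNetwork]

theorem fullNetwork_closed : (fullNetwork arcs τ T).Closed := by
  rintro (e | e) he
  · have := mem_fullNetwork_move.1 (Network.inl_mem_arcs.1 he)
    exact ⟨mem_fullNetwork_nodes.2 this.1, mem_fullNetwork_nodes.2 this.2.1⟩
  · have := mem_fullNetwork_hold.1 (Network.inr_mem_arcs.1 he)
    exact ⟨mem_fullNetwork_nodes.2 this.1, mem_fullNetwork_nodes.2 this.2.1⟩

theorem fullNetwork_hold_fst : ∀ e ∈ (fullNetwork arcs τ T).hold, e.2.1 = e.1.1 :=
  fun _ he => (mem_fullNetwork_hold.1 he).2.2.1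

theorem fullNetwork_time (hτ : ∀ a ∈ arcs, 0 < τ a) :
    ∀ e ∈ (fullNetwork arcs τ T).arcs, (tail e).2 < (head e).2 := by
  rintro (e | e) he
  · obtain ⟨-, -, h, h'⟩ := mem_fullNetwork_move.1 (Network.inl_mem_arcs.1 he)
    have := hτ _ h
    simp only [tail_inl, head_inl]
    omega
  · obtain ⟨-, -, h, h'⟩ := mem_fullNetwork_hold.1 (Network.inr_mem_arcs.1 he)
    simp only [tail_inr, head_inr]
    omega

theorem holdReach_fullNetwork {ns : Finset W} {as : Finset (W × W)} {v : W} {s t : ℕ} (hv : v ∈ ns)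
    (hst : s ≤ t) (ht : t ≤ T) :
    HoldReach ((fullNetwork arcs τ T).restrict ns as) (v, s) (v, t) := by
  induction t, hst using Nat.le_induction with
  | base => exact HoldReach.refl _ _
  | succ t hst ih =>
    refine (ih (by omega)).trans (HoldReach.of_mem (e := ((v, t), (v, t + 1))) ?_)
    exact mem_restrict_hold.2 ⟨mem_fullNetwork_hold.2 ⟨by simp; omega, ht, rfl, rfl⟩, hv⟩

/-- A walk in a full network lasts at least as long as its movements. -/
theorem Walk.sum_transit_le {p q : TNode W} {L : List (TArc W)} (h : Walk p q L)
    (hL : ∀ e ∈ L, e ∈ (fullNetwork arcs τ T).arcs) :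
    p.2 + ((moves L).map fun e => τ (e.1.1, e.2.1)).sum ≤ q.2 := by
  induction L generalizing p with
  | nil => obtain rfl : p = q := h; simp
  | cons e L ih =>
    have h1 := ih h.2 fun e he => hL e (List.mem_cons_of_mem _ he)
    have h2 := hL e List.mem_cons_self
    have h3 := h.1
    subst h3
    cases e with
    | inl e =>
      have := (mem_fullNetwork_move.1 (Network.inl_mem_arcs.1 h2)).2.2.2
      simp only [tail_inl, head_inl, moves_inl, List.map_cons, List.sum_cons] at *
      omega
    | inr e =>
      have := (mem_fullNetwork_hold.1 (Network.inr_mem_arcs.1 h2)).2.2.2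
      simp only [tail_inr, head_inr, moves_inr] at *
      omega

end Full

/-! ### Rounding times down, and partial networks -/

open Classical in
/-- The latest time at most `t` at which `v` has a copy in `S`. -/
def floorTime (S : Finset (TNode W)) (v : W) (t : ℕ) : ℕ :=
  (S.filter fun p => p.1 = v ∧ p.2 ≤ t).sup Prod.snd

theorem floorTime_le (S : Finset (TNode W)) (v : W) (t : ℕ) : floorTime S v t ≤ t :=
  Finset.sup_le fun p hp => by simp at hp; exact hp.2.2

theorem le_floorTime {S : Finset (TNode W)} {v : W} {s t : ℕ} (h : (v, s) ∈ S) (hst : s ≤ t) :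
    s ≤ floorTime S v t :=
  Finset.le_sup (f := Prod.snd) (b := (v, s)) (by simp [h, hst])

/-- The timed node `(v, 0)` makes the filtered set nonempty, so its supremum is attained and is not
merely the default value `0`. -/
theorem floorTime_mem {S : Finset (TNode W)} {v : W} (h0 : (v, 0) ∈ S) (t : ℕ) :
    (v, floorTime S v t) ∈ S := by
  classical
  obtain ⟨p, hp, hp'⟩ := Finset.exists_mem_eq_sup (S.filter fun p => p.1 = v ∧ p.2 ≤ t)
    ⟨(v, 0), by simp [h0]⟩ Prod.snd
  simp only [Finset.mem_filter] at hp
  have : floorTime S v t = p.2 := by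
    rw [← hp', floorTime]
  rw [this, ← hp.2.1]
  exact hp.1

theorem floorTime_mono {S : Finset (TNode W)} {v : W} (h0 : (v, 0) ∈ S) {s t : ℕ} (h : s ≤ t) :
    floorTime S v s ≤ floorTime S v t :=
  le_floorTime (floorTime_mem h0 s) ((floorTime_le S v s).trans h)

theorem floorTime_eq {S : Finset (TNode W)} {v : W} {t : ℕ} (h : (v, t) ∈ S) :
    floorTime S v t = t :=
  le_antisymm (floorTime_le _ _ _) (le_floorTime h le_rfl)

section Partial

variable {arcs : Finset (W × W)} {τ : W × W → ℕ} {T : ℕ} {S : Finset (TNode W)}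

theorem mem_partialNetwork_move {e : TPair W} : e ∈ (partialNetwork arcs τ T S).move ↔
    (e.1 ∈ S ∧ e.2 ∈ S) ∧ (e.1.1, e.2.1) ∈ arcs ∧ e.1.2 + τ (e.1.1, e.2.1) ≤ T ∧
      e.2.2 ≤ e.1.2 + τ (e.1.1, e.2.1) ∧
      ∀ s, (e.2.1, s) ∈ S → s ≤ e.1.2 + τ (e.1.1, e.2.1) → s ≤ e.2.2 := by
  simp only [partialNetwork, Finset.mem_filter, Finset.mem_product]

theorem mem_partialNetwork_hold {e : TPair W} : e ∈ (partialNetwork arcs τ T S).hold ↔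
    (e.1 ∈ S ∧ e.2 ∈ S) ∧
    e.2.1 = e.1.1 ∧ e.1.2 < e.2.2 ∧ ∀ s, (e.1.1, s) ∈ S → ¬ (e.1.2 < s ∧ s < e.2.2) := by
  simp only [partialNetwork, Finset.mem_filter, Finset.mem_product]

theorem partialNetwork_closed : (partialNetwork arcs τ T S).Closed := by
  rintro (e | e) he
  · exact (mem_partialNetwork_move.1 (Network.inl_mem_arcs.1 he)).1
  · exact (mem_partialNetwork_hold.1 (Network.inr_mem_arcs.1 he)).1

theorem partialNetwork_hold_fst : ∀ e ∈ (partialNetwork arcs τ T S).hold, e.2.1 = e.1.1 :=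
  fun _ he => (mem_partialNetwork_hold.1 he).2.1

theorem partialNetwork_hold_lt : ∀ e ∈ (partialNetwork arcs τ T S).hold, e.1.2 < e.2.2 :=
  fun _ he => (mem_partialNetwork_hold.1 he).2.2.1

theorem partialNetwork_move_snd {e e' : TPair W} (he : e ∈ (partialNetwork arcs τ T S).move)
    (he' : e' ∈ (partialNetwork arcs τ T S).move) (h1 : e.1 = e'.1) (h2 : e.2.1 = e'.2.1) :
    e = e' := by
  obtain ⟨⟨-, ha⟩, -, -, hb, hc⟩ := mem_partialNetwork_move.1 he
  obtain ⟨⟨-, ha'⟩, -, -, hb', hc'⟩ := mem_partialNetwork_move.1 he'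
  obtain ⟨p, w, t⟩ := e
  obtain ⟨p', w', t'⟩ := e'
  dsimp only at *
  subst h1 h2
  have := hc _ ha' hb'
  have := hc' _ ha hb
  obtain rfl : t = t' := by omega
  rfl

theorem floor_mem_partialNetwork_move {v w : W} {t : ℕ} (h : (v, t) ∈ S) (ha : (v, w) ∈ arcs)
    (ht : t + τ (v, w) ≤ T) (h0 : (w, 0) ∈ S) :
    ((v, t), (w, floorTime S w (t + τ (v, w)))) ∈ (partialNetwork arcs τ T S).move :=
  mem_partialNetwork_move.2 ⟨⟨h, floorTime_mem h0 _⟩, ha, ht, floorTime_le _ _ _,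
    fun _ hs hs' => le_floorTime hs hs'⟩

theorem holdReach_partialNetwork {ns : Finset W} {as : Finset (W × W)} {v : W} {s t : ℕ}
    (hv : v ∈ ns) (hs : (v, s) ∈ S) (ht : (v, t) ∈ S) (hst : s ≤ t) :
    HoldReach ((partialNetwork arcs τ T S).restrict ns as) (v, s) (v, t) := by
  induction t using Nat.strong_induction_on with
  | _ t ih =>
    rcases hst.eq_or_lt with rfl | hlt
    · exact HoldReach.refl _ _
    · classical
      -- The last copy of `v` before time `t` is joined to `(v, t)` by a storage arc, since no copy
      -- lies between them.
      obtain ⟨p, hp, hmax⟩ := Finset.exists_max_image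
        (S.filter fun p => p.1 = v ∧ p.2 < t) Prod.snd ⟨(v, s), by simp [hs, hlt]⟩
      obtain ⟨v', t'⟩ := p
      simp only [Finset.mem_filter] at hp hmax
      obtain ⟨hpS, rfl, hp2⟩ := hp
      refine (ih t' hp2 hpS (hmax (v', s) ⟨hs, rfl, hlt⟩)).trans
        (HoldReach.of_mem (e := ((v', t'), (v', t))) ?_)
      refine mem_restrict_hold.2 ⟨mem_partialNetwork_hold.2 ⟨⟨hpS, ht⟩, rfl, hp2, ?_⟩, hv⟩
      rintro s' hs' ⟨h1, h2⟩
      have := hmax (v', s') ⟨hs', rfl, h2⟩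
      simp only at this h1
      omega

/-- Rounding the times of a walk in the full network down to times in `S` gives a walk in the
partial network. -/
theorem Walk.exists_floor [Fintype W] {ns : Finset W} {as : Finset (W × W)} {p q : TNode W}
    {L : List (TArc W)} (h : Walk p q L) (has : ∀ a ∈ as, a.1 ∈ ns ∧ a.2 ∈ ns)
    (h0 : ∀ v ∈ ns, (v, 0) ∈ S)
    (hL : ∀ e ∈ L, e ∈ ((fullNetwork arcs τ T).restrict ns as).arcs) :
    ∃ L', Walk (p.1, floorTime S p.1 p.2) (q.1, floorTime S q.1 q.2) L' ∧
      (∀ e ∈ L', e ∈ ((partialNetwork arcs τ T S).restrict ns as).arcs) ∧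
      moves L' = (moves L).map fun e => ((e.1.1, floorTime S e.1.1 e.1.2),
        (e.2.1, floorTime S e.2.1 (floorTime S e.1.1 e.1.2 + τ (e.1.1, e.2.1)))) := by
  induction L generalizing p with
  | nil =>
    obtain rfl : p = q := h
    exact ⟨[], rfl, by simp, rfl⟩
  | cons e L ih =>
    obtain ⟨L', hw, hm, hmv⟩ := ih h.2 fun e he => hL e (List.mem_cons_of_mem _ he)
    have he := hL e List.mem_cons_self
    obtain ⟨rfl, -⟩ := h
    cases e with
    | inl e =>
      obtain ⟨⟨v, t⟩, ⟨w, t'⟩⟩ := e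
      obtain ⟨hf, ha⟩ := mem_restrict_move.1 (Network.inl_mem_arcs.1 he)
      obtain ⟨-, hT, harc, ht'⟩ := mem_fullNetwork_move.1 hf
      simp only [tail_inl, head_inl] at *
      have hns := has _ ha
      have hle := floorTime_le S v t
      -- After departing at the rounded time, the movement arrives no later than the rounded value
      -- of the true arrival time `t'`. Storage arcs bridge the gap.
      obtain ⟨H, hH, hHm, hHa⟩ := holdReach_partialNetwork (arcs := arcs) (τ := τ) (T := T)
        (as := as) hns.2
        (floorTime_mem (h0 _ hns.2) (floorTime S v t + τ (v, w))) (floorTime_mem (h0 _ hns.2) t')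
        (floorTime_mono (h0 _ hns.2) (by omega))
      refine ⟨Sum.inl ((v, floorTime S v t), (w, floorTime S w (floorTime S v t + τ (v, w)))) ::
        (H ++ L'), ⟨rfl, hH.append hw⟩, ?_, by simp [hHm, hmv]⟩
      intro e' he'
      rcases List.mem_cons.1 he' with rfl | he'
      · exact Network.inl_mem_arcs.2 (mem_restrict_move.2
          ⟨floor_mem_partialNetwork_move (floorTime_mem (h0 _ hns.1) _) harc (by omega)
            (h0 _ hns.2), ha⟩)
      · rcases List.mem_append.1 he' with he' | he'
        · exact hHa _ he'
        · exact hm _ he'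
    | inr e =>
      obtain ⟨⟨v, t⟩, ⟨w, t'⟩⟩ := e
      obtain ⟨hf, hv⟩ := mem_restrict_hold.1 (Network.inr_mem_arcs.1 he)
      obtain ⟨-, -, hvw, htt⟩ := mem_fullNetwork_hold.1 hf
      dsimp only at hvw htt hv
      subst hvw htt
      simp only [tail_inr, head_inr] at *
      obtain ⟨H, hH, hHm, hHa⟩ := holdReach_partialNetwork (arcs := arcs) (τ := τ) (T := T)
        (as := as) hv (floorTime_mem (h0 _ hv) t) (floorTime_mem (h0 _ hv) (t + 1))
        (floorTime_mono (h0 _ hv) (by omega))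
      refine ⟨H ++ L', hH.append hw, fun e' he' => ?_, by simp [hHm, hmv]⟩
      rcases List.mem_append.1 he' with he' | he'
      · exact hHa _ he'
      · exact hm _ he'

end Partial

end Nets

/-! ### The auxiliary network and the comparison of the formulations -/

section Formulations

variable {N K : Type*} [Fintype K] [Fintype N] [DecidableEq N] {I : Instance N K}

theorem mem_auxArcs {P : ValidPartition I} {e : AuxNode P × AuxNode P} :
    e ∈ auxArcs P ↔ ∃ B, e.1.2 = some B ∧ (e.1.1, e.2.1) ∈ B.1 := by
  simp [auxArcs]

theorem mem_auxNodes {P : ValidPartition I} {k : K} {n : AuxNode P} : n ∈ auxNodes P k ↔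
    (∃ B, n.2 = some B ∧ n.1 ∈ I.knodes k ∧ (I.kout k n.1).Nonempty ∧ I.kout k n.1 ⊆ B.1) ∨
      n = ⟨I.d k, none⟩ := by
  simp [auxNodes]

theorem mem_auxKArcs {P : ValidPartition I} {k : K} {e : AuxNode P × AuxNode P} :
    e ∈ auxKArcs P k ↔
      (e.1.1, e.2.1) ∈ I.karcs k ∧ e.1 ∈ auxNodes P k ∧ e.2 ∈ auxNodes P k := by
  simp [auxKArcs]

theorem base_mem_of_auxArcs {P : ValidPartition I} {e : AuxNode P × AuxNode P}
    (he : e ∈ auxArcs P) : (e.1.1, e.2.1) ∈ I.arcs := by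
  obtain ⟨B, -, hB⟩ := mem_auxArcs.1 he
  exact (Finset.mem_filter.1 ((P.part e.1.1).le B.2 hB)).1

theorem auxKArcs_ends {P : ValidPartition I} {k : K} :
    ∀ a ∈ auxKArcs P k, a.1 ∈ auxNodes P k ∧ a.2 ∈ auxNodes P k :=
  fun _ ha => (mem_auxKArcs.1 ha).2

/-- No designated arc leaves the destination, so the tail is a copy whose part contains all
designated arcs leaving that node. -/
theorem mem_auxArcs_of_auxKArcs {P : ValidPartition I} {k : K} {e : AuxNode P × AuxNode P}
    (he : e ∈ auxKArcs P k) : e ∈ auxArcs P := by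
  obtain ⟨h1, h2, -⟩ := mem_auxKArcs.1 he
  rcases mem_auxNodes.1 h2 with ⟨B, hB, -, -, hsub⟩ | h
  · exact mem_auxArcs.2 ⟨B, hB, hsub (Finset.mem_filter.2 ⟨h1, rfl⟩)⟩
  · exact absurd (congrArg Sigma.fst h) (I.no_out_d k _ h1)

/-- The tail of an arc of `G` is determined by the flat arc. -/
theorem auxArcs_tail_unique {P : ValidPartition I} {e e' : AuxNode P × AuxNode P}
    (he : e ∈ auxArcs P) (he' : e' ∈ auxArcs P) (h : (e.1.1, e.2.1) = (e'.1.1, e'.2.1)) :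
    e.1 = e'.1 := by
  obtain ⟨B, h1, h2⟩ := mem_auxArcs.1 he
  obtain ⟨B', h1', h2'⟩ := mem_auxArcs.1 he'
  obtain ⟨⟨v, b⟩, w, c⟩ := e
  obtain ⟨⟨v', b'⟩, w', c'⟩ := e'
  simp only [Prod.mk.injEq] at h
  obtain ⟨rfl, rfl⟩ := h
  dsimp only at *
  rw [h1, h1', Subtype.ext ((P.part v).eq_of_mem_parts B.2 B'.2 h2 h2')]

theorem auxOrigin_mem (P : ValidPartition I) (k : K) : auxOrigin P k ∈ auxNodes P k :=
  (existsUnique_origin P k).choose_spec.1.1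

theorem auxOrigin_fst (P : ValidPartition I) (k : K) : (auxOrigin P k).1 = I.o k :=
  (existsUnique_origin P k).choose_spec.1.2

theorem auxDest_mem (P : ValidPartition I) (k : K) : (⟨I.d k, none⟩ : AuxNode P) ∈ auxNodes P k :=
  mem_auxNodes.2 (Or.inr rfl)

theorem auxOrigin_ne (P : ValidPartition I) (k : K) : auxOrigin P k ≠ ⟨I.d k, none⟩ := by
  intro h
  have := congrArg Sigma.fst h
  rw [auxOrigin_fst] at this
  exact I.o_ne_d k this

theorem source_ne_sink (P : ValidPartition I) (k : K) : source P k ≠ sink P k :=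
  fun h => auxOrigin_ne P k (congrArg Prod.fst h)

theorem fst_mem_knodes {P : ValidPartition I} {k : K} {n : AuxNode P} (hn : n ∈ auxNodes P k) :
    n.1 ∈ I.knodes k := by
  rcases mem_auxNodes.1 hn with ⟨B, -, h, -⟩ | rfl
  · exact h
  · exact I.d_mem k

/-- A node other than the destination has a designated outgoing arc, and validity of the partition
supplies the part that defines its copy. -/
theorem exists_copy (P : ValidPartition I) {k : K} {v : N} (hv : v ∈ I.knodes k) :
    ∃ n ∈ auxNodes P k, n.1 = v := by
  by_cases h : v = I.d k
  · exact ⟨⟨I.d k, none⟩, auxDest_mem P k, h.symm⟩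
  · obtain ⟨a, ha, hav⟩ := I.exists_out k v hv h
    have hmem : a ∈ I.kout k v := Finset.mem_filter.2 ⟨ha, hav⟩
    obtain ⟨B, hB, hsub⟩ := P.valid k v ⟨a, hmem⟩
    exact ⟨⟨v, some ⟨B, hB⟩⟩, mem_auxNodes.2 (Or.inl ⟨⟨B, hB⟩, rfl, hv, ⟨a, hmem⟩, hsub⟩), rfl⟩

theorem eq_dest {P : ValidPartition I} {k : K} {n : AuxNode P} (hn : n ∈ auxNodes P k)
    (h : n.1 = I.d k) : n = ⟨I.d k, none⟩ := by
  rcases mem_auxNodes.1 hn with ⟨B, -, -, ⟨a, ha⟩, -⟩ | h'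
  · obtain ⟨h1, h2⟩ := Finset.mem_filter.1 ha
    exact absurd (h2.trans h) (I.no_out_d k a h1)
  · exact h'

theorem le_T (I : Instance N K) (k : K) : I.l k ≤ I.T := Finset.le_sup (Finset.mem_univ k)

theorem truckSystem_DT (I : Instance N K) :
    TruckSystem I id I.DT I.DT.move (fun a => {a}) := by
  have hinj : Set.InjOn (key (id : N → N)) (I.DT.move : Set (TPair N)) := by
    rintro ⟨⟨v, t⟩, w, t'⟩ ha ⟨⟨v', s⟩, w', s'⟩ hb h
    have h1 := (mem_fullNetwork_move.1 ha).2.2.2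
    have h2 := (mem_fullNetwork_move.1 hb).2.2.2
    simp only [key, baseArc, id, Prod.mk.injEq] at h h1 h2
    obtain ⟨⟨rfl, rfl⟩, rfl⟩ := h
    rw [h1, h2]
  refine ⟨fun a ha e => ?_, hinj, fun e he => ⟨e, he, rfl⟩, fun a ha =>
    (mem_fullNetwork_move.1 ha).2.2.1⟩
  rw [Finset.mem_singleton]
  exact ⟨by rintro rfl; exact ⟨ha, rfl⟩, fun h => hinj h.1 ha h.2⟩

theorem projMove_mem {P : ValidPartition I} {e : TPair (AuxNode P)} (he : e ∈ (GT P).move) :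
    ((e.1.1.1, e.1.2), (e.2.1.1, e.2.2)) ∈ I.DT.move := by
  obtain ⟨h1, h2, h3, h4⟩ := mem_fullNetwork_move.1 he
  exact mem_fullNetwork_move.2 ⟨h1, h2, base_mem_of_auxArcs h3, h4⟩

theorem truckSystem_GT (P : ValidPartition I) :
    TruckSystem I (proj P) (GT P) I.DT.move (copiesT P) := by
  have h := truckSystem_DT I
  refine ⟨fun a ha e => ?_, h.inj, fun e he => ⟨_, projMove_mem he, rfl⟩, h.base_mem⟩
  simp only [copiesT, Finset.mem_filter]
  refine and_congr_right fun he => ⟨fun h' => h' ▸ rfl, fun h' => ?_⟩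
  exact h.inj (projMove_mem he) ha h'

/-- The representative in `DS` rounds its arrival over all copies of the head, and so may arrive
later than the arc of `G_S` to one particular copy. For this reason a key records only the departure
time. -/
theorem truckSystem_GS {P : ValidPartition I} {S : Finset (TNode (AuxNode P))}
    (hS : ∀ n, (n, 0) ∈ S) : TruckSystem I (proj P) (GS P S) (DS P S).move (copiesS P S) := by
  have himg : ∀ p ∈ S, (p.1.1, p.2) ∈ S.image fun p => (p.1.1, p.2) := fun p hp =>
    Finset.mem_image_of_mem (fun p : TNode (AuxNode P) => (p.1.1, p.2)) hp
  refine ⟨fun a ha e => ?_, ?_, fun e he => ?_, fun a ha => (mem_partialNetwork_move.1 ha).2.1⟩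
  · obtain ⟨⟨v, t⟩, w, t'⟩ := a
    obtain ⟨⟨v', s⟩, w', s'⟩ := e
    simp only [copiesS, Finset.mem_filter, key, baseArc, proj, id, Prod.mk.injEq]
    tauto
  · intro a ha b hb h
    have h' := h
    simp only [key, baseArc, id, Prod.mk.injEq] at h'
    exact partialNetwork_move_snd ha hb (Prod.ext h'.1.1 h'.2) h'.1.2
  · obtain ⟨⟨h1, h2⟩, h3, h4, -⟩ := mem_partialNetwork_move.1 he
    refine ⟨_, floor_mem_partialNetwork_move (himg _ h1) (base_mem_of_auxArcs h3) h4
      (himg _ (hS e.2.1)), rfl⟩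

/-! ### Designated networks of the commodities -/

/-- The part of `G_T` over the designated subgraph of `k`. -/
abbrev GTk (P : ValidPartition I) (k : K) : Network (AuxNode P) :=
  (GT P).restrict (auxNodes P k) (auxKArcs P k)

/-- The part of `G_S` over the designated subgraph of `k`. -/
abbrev GSk (P : ValidPartition I) (S : Finset (TNode (AuxNode P))) (k : K) :
    Network (AuxNode P) :=
  (GS P S).restrict (auxNodes P k) (auxKArcs P k)

/-- The part of `D_T` over the designated subgraph of `k`. -/
abbrev DTk (I : Instance N K) (k : K) : Network N :=
  I.DT.restrict (I.knodes k) (I.karcs k)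

theorem GTk_time {P : ValidPartition I} {k : K} {e : TArc (AuxNode P)} (he : e ∈ (GTk P k).arcs) :
    (tail e).2 < (head e).2 :=
  fullNetwork_time (fun _ ha => I.τ_pos _ (base_mem_of_auxArcs ha)) e (restrict_arcs_subset he)

theorem DTk_time {k : K} {e : TArc N} (he : e ∈ (DTk I k).arcs) :
    (tail e).2 < (head e).2 :=
  fullNetwork_time (fun _ ha => I.τ_pos _ ha) e (restrict_arcs_subset he)

/-- The total transit time of a walk in `G_T` from source to sink. -/
theorem GTk_transit {P : ValidPartition I} {k : K} {L : List (TArc (AuxNode P))}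
    (h : Walk (source P k) (sink P k) L) (hL : ∀ e ∈ L, e ∈ (GTk P k).arcs) :
    I.r k + ((moves L).map fun e => I.τ (baseArc (proj P) e)).sum ≤ I.l k :=
  h.sum_transit_le (fun e he => restrict_arcs_subset (hL e he))

/-! ### From `D_T` to `G_T` and back -/

open Classical in
/-- The copy of a node in the designated subgraph of `k` in `G`. -/
def auxCopy (P : ValidPartition I) (k : K) (v : N) : AuxNode P :=
  -- The value off the designated subgraph only has to lie over `v`, so that `auxCopy_fst` needs no
  -- hypothesis.
  if h : v ∈ I.knodes k then (exists_copy P h).choose else ⟨v, none⟩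

theorem auxCopy_mem {P : ValidPartition I} {k : K} {v : N} (h : v ∈ I.knodes k) :
    auxCopy P k v ∈ auxNodes P k := by
  rw [auxCopy, dif_pos h]
  exact (exists_copy P h).choose_spec.1

theorem auxCopy_fst (P : ValidPartition I) (k : K) (v : N) : (auxCopy P k v).1 = v := by
  unfold auxCopy
  split_ifs with h
  · exact (exists_copy P h).choose_spec.2
  · rfl

theorem auxCopy_origin (P : ValidPartition I) (k : K) : auxCopy P k (I.o k) = auxOrigin P k :=
  (existsUnique_origin P k).choose_spec.2 _ ⟨auxCopy_mem (I.o_mem k), auxCopy_fst P k _⟩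

theorem auxCopy_dest (P : ValidPartition I) (k : K) : auxCopy P k (I.d k) = ⟨I.d k, none⟩ :=
  eq_dest (auxCopy_mem (I.d_mem k)) (auxCopy_fst P k _)

theorem DTk_closed (k : K) : (DTk I k).Closed :=
  fullNetwork_closed.restrict fullNetwork_hold_fst fun a ha => ⟨I.fst_mem k a ha, I.snd_mem k a ha⟩

theorem GTk_closed (P : ValidPartition I) (k : K) : (GTk P k).Closed :=
  fullNetwork_closed.restrict fullNetwork_hold_fst auxKArcs_ends

theorem GSk_closed (P : ValidPartition I) (S : Finset (TNode (AuxNode P))) (k : K) :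
    (GSk P S k).Closed :=
  partialNetwork_closed.restrict partialNetwork_hold_fst auxKArcs_ends

theorem lift_mem {P : ValidPartition I} {k : K} {e : TArc N} (he : e ∈ (DTk I k).arcs) :
    mapArc (auxCopy P k) e ∈ (GTk P k).arcs := by
  cases e with
  | inl e =>
    obtain ⟨h1, h2⟩ := mem_restrict_move.1 (Network.inl_mem_arcs.1 he)
    obtain ⟨ha, hb, hc, hd⟩ := mem_fullNetwork_move.1 h1
    have hk : (auxCopy P k e.1.1, auxCopy P k e.2.1) ∈ auxKArcs P k := by
      refine mem_auxKArcs.2 ⟨?_, auxCopy_mem (I.fst_mem k _ h2), auxCopy_mem (I.snd_mem k _ h2)⟩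
      simpa only [auxCopy_fst] using h2
    refine Network.inl_mem_arcs.2 (mem_restrict_move.2 ⟨mem_fullNetwork_move.2
      ⟨ha, hb, mem_auxArcs_of_auxKArcs hk, ?_⟩, hk⟩)
    simpa only [auxτ, auxCopy_fst] using hd
  | inr e =>
    obtain ⟨h1, h2⟩ := mem_restrict_hold.1 (Network.inr_mem_arcs.1 he)
    obtain ⟨ha, hb, hc, hd⟩ := mem_fullNetwork_hold.1 h1
    refine Network.inr_mem_arcs.2 (mem_restrict_hold.2 ⟨mem_fullNetwork_hold.2
      ⟨ha, hb, ?_, hd⟩, auxCopy_mem h2⟩)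
    simp only [hc]

theorem projArc_mem {P : ValidPartition I} {k : K} {e : TArc (AuxNode P)}
    (he : e ∈ (GTk P k).arcs) : projArc P e ∈ (DTk I k).arcs := by
  cases e with
  | inl e =>
    obtain ⟨h1, h2⟩ := mem_restrict_move.1 (Network.inl_mem_arcs.1 he)
    exact Network.inl_mem_arcs.2 (mem_restrict_move.2 ⟨projMove_mem h1, (mem_auxKArcs.1 h2).1⟩)
  | inr e =>
    obtain ⟨h1, h2⟩ := mem_restrict_hold.1 (Network.inr_mem_arcs.1 he)
    obtain ⟨ha, hb, hc, hd⟩ := mem_fullNetwork_hold.1 h1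
    refine Network.inr_mem_arcs.2 (mem_restrict_hold.2 ⟨mem_fullNetwork_hold.2
      ⟨ha, hb, ?_, hd⟩, fst_mem_knodes h2⟩)
    simp only [hc]

/-- A feasible solution over `D_T` gives a family of walks in `G_T` whose plan is not more
expensive. -/
theorem exists_GT_of_feasibleDT (P : ValidPartition I) {z : Solution N N K}
    (hz : I.FeasibleDT z) : ∃ L : K → List (TArc (AuxNode P)),
      (∀ k, Walk (source P k) (sink P k) (L k)) ∧ (∀ k, ∀ e ∈ L k, e ∈ (GTk P k).arcs) ∧
      planCost I (planOf (proj P) L) ≤ I.costDT z := by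
  have h : ∀ k, ∃ L, IsTrajectory (DTk I k) (I.o k, I.r k) (I.d k, I.l k) L ∧
      ∀ e ∈ L, z.x k e = 1 := fun k =>
    (hz.1 k).exists_trajectory (DTk_closed k)
      (mem_restrict_nodes.2 ⟨mem_fullNetwork_nodes.2 (le_T I k), I.d_mem k⟩)
      fun h => I.o_ne_d k (congrArg Prod.fst h)
  choose L hL hx using h
  refine ⟨fun k => (L k).map (mapArc (auxCopy P k)), fun k => ?_, fun k e he => ?_, ?_⟩
  · have := (hL k).walk.map (auxCopy P k)
    rwa [auxCopy_origin, auxCopy_dest] at this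
  · obtain ⟨e', he', rfl⟩ := List.mem_map.1 he
    exact lift_mem ((hL k).1 e' he')
  · have h2 : planOf (proj P) (fun k => (L k).map (mapArc (auxCopy P k))) = planOf id L := by
      funext k
      rw [planOf, planOf, moves_map, List.map_map]
      refine List.map_congr_left fun e _ => ?_
      simp [key, baseArc, proj, auxCopy_fst]
    rw [h2]
    exact (truckSystem_DT I).planCost_le (fun k => (hL k).nodup)
      (fun k e he => restrict_arcs_subset ((hL k).1 e he)) hx hz.2

/-- A feasible solution over `G_T` contains a family of walks whose plan is not more expensive. -/
theorem exists_walks_of_feasibleGT (P : ValidPartition I) {z : Solution (AuxNode P) N K}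
    (hz : FeasibleGT P z) : ∃ L : K → List (TArc (AuxNode P)),
      (∀ k, Walk (source P k) (sink P k) (L k)) ∧ (∀ k, ∀ e ∈ L k, e ∈ (GTk P k).arcs) ∧
      planCost I (planOf (proj P) L) ≤ costGT P z := by
  have h : ∀ k, ∃ L, IsTrajectory (GTk P k) (source P k) (sink P k) L ∧
      ∀ e ∈ L, z.x k e = 1 := fun k =>
    (hz.1 k).exists_trajectory (GTk_closed P k)
      (mem_restrict_nodes.2 ⟨mem_fullNetwork_nodes.2 (le_T I k), auxDest_mem P k⟩)
      (source_ne_sink P k)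
  choose L hL hx using h
  exact ⟨L, fun k => (hL k).walk, fun k => (hL k).1,
    (truckSystem_GT P).planCost_le (fun k => (hL k).nodup)
      (fun k e he => restrict_arcs_subset ((hL k).1 e he)) hx hz.2⟩

/-- The solution over `G_T` given by a family of walks. -/
theorem walks_GT {P : ValidPartition I} {L : K → List (TArc (AuxNode P))}
    (hw : ∀ k, Walk (source P k) (sink P k) (L k)) (hL : ∀ k, ∀ e ∈ L k, e ∈ (GTk P k).arcs)
    {z : Solution (AuxNode P) N K} (hx : ∀ k, z.x k = indicator (L k))
    (hy : ∀ a ∈ I.DT.move, z.y a = planTrucks I (planOf (proj P) L) (key id a)) :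
    FeasibleGT P z ∧ costGT P z = planCost I (planOf (proj P) L) := by
  have hn : ∀ k, (L k).Nodup := fun k => List.Nodup.of_map _
    (List.Nodup.of_append_left ((hw k).nodup_of_time fun e he => GTk_time (hL k e he)).1)
  have hL' : ∀ k, ∀ e ∈ L k, e ∈ (GT P).arcs := fun k e he => restrict_arcs_subset (hL k e he)
  have hzx : z.x = fun k => indicator (L k) := funext hx
  refine ⟨⟨fun k => ?_, fun a ha => ?_⟩, ?_⟩
  · rw [hx k]
    exact (hw k).isUnitFlow (source_ne_sink P k) (hn k) (hL k)
  · rw [hzx]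
    exact (truckSystem_GT P).load_le hn hL' ha (hy a ha)
  · rw [costGT, hzx]
    exact (truckSystem_GT P).planCost_eq hn hL' hy

/-- The projection to `D_T` of the solution over `G_T` given by a family of walks. -/
theorem project_walks {P : ValidPartition I} {L : K → List (TArc (AuxNode P))}
    (hw : ∀ k, Walk (source P k) (sink P k) (L k)) (hL : ∀ k, ∀ e ∈ L k, e ∈ (GTk P k).arcs)
    {z : Solution (AuxNode P) N K} (hx : ∀ k, z.x k = indicator (L k))
    (hy : ∀ a ∈ I.DT.move, z.y a = planTrucks I (planOf (proj P) L) (key id a)) :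
    I.FeasibleDT (project P z) ∧
      I.costDT (project P z) = planCost I (planOf (proj P) L) := by
  classical
  set L' : K → List (TArc N) := fun k => (L k).map (mapArc (proj P)) with hL'
  have hw' : ∀ k, Walk (I.o k, I.r k) (I.d k, I.l k) (L' k) := fun k => by
    have := (hw k).map (proj P)
    have ho : proj P (source P k).1 = I.o k := auxOrigin_fst P k
    rwa [ho] at this
  have hmem : ∀ k, ∀ e ∈ L' k, e ∈ (DTk I k).arcs := fun k e he => by
    obtain ⟨e', he', rfl⟩ := List.mem_map.1 he
    exact projArc_mem (hL k e' he')
  have hmem' : ∀ k, ∀ e ∈ L' k, e ∈ I.DT.arcs := fun k e he => restrict_arcs_subset (hmem k e he)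
  have hn : ∀ k, (L' k).Nodup := fun k => List.Nodup.of_map _
    (List.Nodup.of_append_left ((hw' k).nodup_of_time fun e he => DTk_time (hmem k e he)).1)
  have hplan : planOf id L' = planOf (proj P) L := by
    funext k
    rw [planOf, planOf, moves_map, List.map_map]
    rfl
  -- The projected walk moves forward in time and repeats no arc. Hence each timed arc of `D_T`
  -- receives at most one used copy, and the projected flow stays binary.
  have hpx : (project P z).x = fun k => indicator (L' k) := by
    funext k a
    have hnL : (L k).Nodup := List.Nodup.of_map _ (hn k)
    simp only [project, hx k]
    by_cases ha : a ∈ L' k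
    · obtain ⟨e, he, hea⟩ := List.mem_map.1 ha
      rw [indicator_eq_one.2 ha, Finset.sum_eq_single e]
      · exact indicator_eq_one.2 he
      · intro e' he' hne
        have : e' ∉ L k := fun h' => hne (List.inj_on_of_nodup_map (hn k) h' he
          ((Finset.mem_filter.1 he').2.trans hea.symm))
        simp [indicator, this]
      · intro h
        exact absurd (Finset.mem_filter.2 ⟨restrict_arcs_subset (hL k e he), hea⟩) h
    · have h0 : indicator (L' k) a = 0 := by simp [indicator, ha]
      rw [h0]
      refine Finset.sum_eq_zero fun e he => ?_
      have : e ∉ L k := fun h' => ha (List.mem_map.2 ⟨e, h', (Finset.mem_filter.1 he).2⟩)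
      simp [indicator, this]
  have hy' : ∀ a ∈ I.DT.move, (project P z).y a = planTrucks I (planOf id L') (key id a) := by
    rw [hplan]
    exact hy
  refine ⟨⟨fun k => ?_, fun a ha => ?_⟩, ?_⟩
  · rw [hpx]
    exact (hw' k).isUnitFlow (fun h => I.o_ne_d k (congrArg Prod.fst h)) (hn k) (hmem k)
  · rw [hpx]
    exact (truckSystem_DT I).load_le hn hmem' ha (hy' a ha)
  · rw [Instance.costDT, hpx, ← hplan]
    exact (truckSystem_DT I).planCost_eq hn hmem' hy'

/-! ### From `G_T` to `G_S` -/

open Classical in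
/-- Rounding down the departure time of a movement to a time at which the copy of the tail that
the movement leaves belongs to `S`. -/
def floorKey (P : ValidPartition I) (S : Finset (TNode (AuxNode P))) (κ : (N × N) × ℕ) :
    (N × N) × ℕ :=
  if h : ∃ e ∈ auxArcs P, (e.1.1, e.2.1) = κ.1 then (κ.1, floorTime S h.choose.1 κ.2) else κ

theorem floorKey_fst (P : ValidPartition I) (S : Finset (TNode (AuxNode P)))
    (κ : (N × N) × ℕ) : (floorKey P S κ).1 = κ.1 := by
  unfold floorKey
  split_ifs <;> rfl

/-- The arc chosen in `floorKey` has the same tail as `e` by `auxArcs_tail_unique`. The rounded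
departure is thus a function of the key alone, and rounding cannot separate movements that share a
truck. -/
theorem floorKey_key {P : ValidPartition I} {S : Finset (TNode (AuxNode P))}
    {e : TPair (AuxNode P)} (he : (e.1.1, e.2.1) ∈ auxArcs P) :
    floorKey P S (key (proj P) e) = (baseArc (proj P) e, floorTime S e.1.1 e.1.2) := by
  have h : ∃ e' ∈ auxArcs P, (e'.1.1, e'.2.1) = (key (proj P) e).1 := ⟨_, he, rfl⟩
  rw [floorKey, dif_pos h, auxArcs_tail_unique h.choose_spec.1 he h.choose_spec.2]
  rfl

/-- Walks in `G_T` give paths in `G_S` whose plan is not more expensive. -/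
theorem exists_GS_of_walks_GT {P : ValidPartition I} {S : Finset (TNode (AuxNode P))}
    (hS : initialNodes P ⊆ S) {L : K → List (TArc (AuxNode P))}
    (hw : ∀ k, Walk (source P k) (sink P k) (L k)) (hL : ∀ k, ∀ e ∈ L k, e ∈ (GTk P k).arcs) :
    ∃ z, FeasibleGS P S z ∧ costGS P S z ≤ planCost I (planOf (proj P) L) := by
  have h0 : ∀ n, (n, 0) ∈ S := fun n => hS (by simp [initialNodes])
  have hsrc : ∀ k, source P k ∈ S := fun k => hS (by simp [initialNodes])
  have hsnk : ∀ k, sink P k ∈ S := fun k => hS (by simp [initialNodes])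
  have h : ∀ k, ∃ L', Walk (source P k) (sink P k) L' ∧ L'.Nodup ∧
      (∀ e ∈ L', e ∈ (GSk P S k).arcs) ∧
      (moves L').Sublist ((moves (L k)).map fun e => ((e.1.1, floorTime S e.1.1 e.1.2),
        (e.2.1, floorTime S e.2.1 (floorTime S e.1.1 e.1.2 + auxτ P (e.1.1, e.2.1))))) := by
    intro k
    obtain ⟨L', hw', hm', hmv⟩ := (hw k).exists_floor auxKArcs_ends (fun v _ => h0 v) (hL k)
    -- Short arcs may go back in time, so the rounded walk can contain cycles. Removing them only
    -- drops movements.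
    obtain ⟨L'', hs, hw'', hn⟩ := hw'.exists_simple
    have e1 : ((source P k).1, floorTime S (source P k).1 (source P k).2) = source P k :=
      Prod.ext rfl (floorTime_eq (hsrc k))
    have e2 : ((sink P k).1, floorTime S (sink P k).1 (sink P k).2) = sink P k :=
      Prod.ext rfl (floorTime_eq (hsnk k))
    rw [e1, e2] at hw''
    exact ⟨L'', hw'', List.Nodup.of_map _ (List.Nodup.of_append_left hn),
      fun e he => hm' e (hs.subset he), hmv ▸ hs.filterMap _⟩
  choose L' hw' hn hm hs using h
  have hm' : ∀ k, ∀ e ∈ L' k, e ∈ (GS P S).arcs := fun k e he => restrict_arcs_subset (hm k e he)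
  have hT := truckSystem_GS h0
  refine ⟨⟨fun k => indicator (L' k), fun a => planTrucks I (planOf (proj P) L') (key id a)⟩,
    ⟨fun k => (hw' k).isUnitFlow (source_ne_sink P k) (hn k) (hm k),
      fun a ha => hT.load_le hn hm' ha rfl, fun k => ?_⟩, ?_⟩
  · rw [sum_move_indicator _ (hn k) (hm k) fun e => (I.τ (baseArc (proj P) e) : ℤ)]
    -- Rounding leaves the actual transit times unchanged, so the duration is bounded by that of the
    -- walk in `G_T`.
    have h1 : ((moves (L' k)).map fun e => I.τ (baseArc (proj P) e)).sum ≤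
        ((moves (L k)).map fun e => I.τ (baseArc (proj P) e)).sum := by
      refine (((hs k).map _).sum_le_sum fun _ _ => Nat.zero_le _).trans (le_of_eq ?_)
      rw [List.map_map]
      rfl
    have h2 := GTk_transit (hw k) (hL k)
    have h3 : ((moves (L' k)).map fun e => (I.τ (baseArc (proj P) e) : ℤ)).sum =
        (((moves (L' k)).map fun e => I.τ (baseArc (proj P) e)).sum : ℕ) := by
      rw [Nat.cast_list_sum, List.map_map]
      rfl
    rw [h3]
    omega
  · have hc : costGS P S ⟨fun k => indicator (L' k),
        fun a => planTrucks I (planOf (proj P) L') (key id a)⟩ =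
        planCost I (planOf (proj P) L') := hT.planCost_eq hn hm' fun _ _ => rfl
    rw [hc]
    refine planCost_le_of_sublist_map I (floorKey P S) (floorKey_fst P S) (fun k => ?_)
      ((truckSystem_GT P).planOf_arc_mem fun k e he => restrict_arcs_subset (hL k e he))
    have := (hs k).map (key (proj P))
    convert this using 1
    · rfl
    rw [planOf, List.map_map, List.map_map]
    refine List.map_congr_left fun e he => ?_
    have hk := (mem_restrict_move.1 (Network.inl_mem_arcs.1 (hL k _ (mem_moves.1 he)))).2
    exact floorKey_key (mem_auxArcs_of_auxKArcs hk)

end Formulations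

/-! ### Randomized rounding with a common shift -/

section Rounding

open intervalIntegral

theorem intervalIntegrable_floor_add (a : ℝ) :
    IntervalIntegrable (fun θ : ℝ => (⌊a + θ⌋ : ℝ)) MeasureTheory.volume 0 1 := by
  refine Monotone.intervalIntegrable fun x y hxy => ?_
  exact_mod_cast Int.floor_mono (by linarith)

/-- The floor is the identity minus the fractional part. By periodicity the latter integrates to `1
/ 2` over every unit interval, while the identity integrates to `a + 1 / 2`. -/
theorem integral_floor_add (a : ℝ) : ∫ θ in (0 : ℝ)..1, (⌊a + θ⌋ : ℝ) = a := by
  have hfl : IntervalIntegrable (fun u : ℝ => (⌊u⌋ : ℝ)) MeasureTheory.volume a (a + 1) :=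
    Monotone.intervalIntegrable fun x y hxy => by exact_mod_cast Int.floor_mono hxy
  have h1 : ∫ θ in (0 : ℝ)..1, (⌊a + θ⌋ : ℝ) = ∫ u in a..(a + 1), (⌊u⌋ : ℝ) := by
    rw [integral_comp_add_left (fun u : ℝ => (⌊u⌋ : ℝ)) a, add_zero]
  have hper : Function.Periodic (Int.fract : ℝ → ℝ) 1 := Int.fract_add_one
  have h2 : ∫ u in a..(a + 1), Int.fract u = 1 / 2 := by
    rw [hper.intervalIntegral_add_eq a 0, zero_add]
    have : ∫ u in (0 : ℝ)..1, Int.fract u = ∫ u in (0 : ℝ)..1, u := by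
      refine integral_congr_ae ?_
      have hne : ∀ᵐ u : ℝ, u ≠ 1 := MeasureTheory.Measure.ae_ne _ 1
      filter_upwards [hne] with u hu hmem
      rw [Set.uIoc_of_le zero_le_one] at hmem
      exact Int.fract_eq_self.2 ⟨hmem.1.le, lt_of_le_of_ne hmem.2 hu⟩
    rw [this]
    norm_num
  have h3 : ∫ u in a..(a + 1), Int.fract u = (∫ u in a..(a + 1), u) -
      ∫ u in a..(a + 1), (⌊u⌋ : ℝ) := by
    rw [← integral_sub intervalIntegrable_id hfl]
    rfl
  have h4 : ∫ u in a..(a + 1), u = a + 1 / 2 := by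
    rw [integral_id]
    ring
  rw [h1]
  linarith

/-- A common shift followed by the floor preserves order, so the sign of the difference is constant
in `θ` and the absolute value comes out of the integral. -/
theorem integral_abs_floor_sub (a b : ℝ) :
    IntervalIntegrable (fun θ : ℝ => |(⌊a + θ⌋ : ℝ) - (⌊b + θ⌋ : ℝ)|) MeasureTheory.volume 0 1 ∧
    ∫ θ in (0 : ℝ)..1, |(⌊a + θ⌋ : ℝ) - (⌊b + θ⌋ : ℝ)| = |a - b| := by
  wlog h : b ≤ a generalizing a b
  · have := this b a (le_of_not_ge h)
    simpa only [abs_sub_comm] using this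
  have h1 : (fun θ : ℝ => |(⌊a + θ⌋ : ℝ) - (⌊b + θ⌋ : ℝ)|) =
      fun θ : ℝ => (⌊a + θ⌋ : ℝ) - (⌊b + θ⌋ : ℝ) := by
    funext θ
    refine abs_of_nonneg (sub_nonneg.2 ?_)
    exact_mod_cast Int.floor_mono (by linarith)
  rw [h1, integral_sub (intervalIntegrable_floor_add a) (intervalIntegrable_floor_add b),
    integral_floor_add, integral_floor_add, abs_of_nonneg (sub_nonneg.2 h)]
  exact ⟨(intervalIntegrable_floor_add a).sub (intervalIntegrable_floor_add b), rfl⟩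

/-- Rounding at a suitable threshold does not increase a sum of absolute differences. -/
theorem exists_floor_sum_le {ι : Type*} (s : Finset ι) (a b : ι → ℝ) :
    ∃ θ : ℝ, 0 ≤ θ ∧ θ < 1 ∧
      ∑ i ∈ s, |(⌊a i + θ⌋ : ℝ) - (⌊b i + θ⌋ : ℝ)| ≤ ∑ i ∈ s, |a i - b i| := by
  -- If every threshold increased the sum, so would its average over `θ`, which equals the
  -- right-hand side.
  by_contra! hcon
  have hint : IntervalIntegrable (fun θ : ℝ => ∑ i ∈ s, |(⌊a i + θ⌋ : ℝ) - (⌊b i + θ⌋ : ℝ)|)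
      MeasureTheory.volume 0 1 := by
    have heq : (fun θ : ℝ => ∑ i ∈ s, |(⌊a i + θ⌋ : ℝ) - (⌊b i + θ⌋ : ℝ)|) =
        ∑ i ∈ s, fun θ : ℝ => |(⌊a i + θ⌋ : ℝ) - (⌊b i + θ⌋ : ℝ)| := by
      funext θ
      simp
    rw [heq]
    exact IntervalIntegrable.sum s fun i _ => (integral_abs_floor_sub (a i) (b i)).1
  have hpos := intervalIntegral_pos_of_pos_on (a := 0) (b := 1)
    (f := fun θ : ℝ => (∑ i ∈ s, |(⌊a i + θ⌋ : ℝ) - (⌊b i + θ⌋ : ℝ)|) - ∑ i ∈ s, |a i - b i|)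
    (hint.sub intervalIntegrable_const)
    (fun θ hθ => sub_pos.2 (hcon θ hθ.1.le hθ.2)) zero_lt_one
  rw [integral_sub hint intervalIntegrable_const,
    integral_finsetSum fun i _ => (integral_abs_floor_sub (a i) (b i)).1] at hpos
  simp [(integral_abs_floor_sub _ _).2] at hpos

end Rounding

/-! ### Optimal solutions of the lower bound formulation and their trajectories -/

section Formulations

variable {N K : Type*} [Fintype K] [Fintype N] [DecidableEq N] {I : Instance N K}
  {P : ValidPartition I} {S : Finset (TNode (AuxNode P))}

/-- SND-RR(`G_S`) has an optimal solution if it is feasible. -/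
theorem exists_optimalGS (hS : ∀ n, (n, 0) ∈ S) (hz : ∃ z, FeasibleGS P S z) :
    ∃ z, OptimalGS P S z := by
  classical
  have hT := truckSystem_GS hS
  -- For a fixed flow the least sufficient trucks are the cheapest, so only the flow remains to be
  -- optimized.
  let Y : (K → TArc (AuxNode P) → ℕ) → TPair N → ℕ := fun x a =>
    ⌈load I (copiesS P S a) x / (I.u (baseArc id a) : ℝ)⌉₊
  have hu : ∀ a ∈ (DS P S).move, (0 : ℝ) < I.u (baseArc id a) := fun a ha => by
    exact_mod_cast I.u_pos _ (hT.base_mem a ha)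
  have hY : ∀ z, FeasibleGS P S z → FeasibleGS P S ⟨z.x, Y z.x⟩ ∧
      costGS P S ⟨z.x, Y z.x⟩ ≤ costGS P S z := by
    intro z hz
    refine ⟨⟨hz.1, fun a ha => ?_, hz.2.2⟩, add_le_add (Finset.sum_le_sum fun a ha => ?_) le_rfl⟩
    · rw [mul_comm, ← div_le_iff₀ (hu a ha)]
      exact Nat.le_ceil _
    · refine mul_le_mul_of_nonneg_left ?_ (I.f_pos _ (hT.base_mem a ha)).le
      have h2 : Y z.x a ≤ z.y a := by
        refine Nat.ceil_le.2 ?_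
        rw [div_le_iff₀ (hu a ha), mul_comm]
        exact hz.2.1 a ha
      exact_mod_cast h2
  -- A feasible flow is determined by the set of network arcs it uses, so there are finitely many
  -- cases to minimize over.
  let code : Solution (AuxNode P) N K → K → {e // e ∈ (GS P S).arcs} → Prop :=
    fun z k e => z.x k e.1 = 1
  let C := {c // ∃ z, FeasibleGS P S z ∧ code z = c}
  let rep : C → Solution (AuxNode P) N K := fun c => c.2.choose
  have hrep : ∀ c : C, FeasibleGS P S (rep c) ∧ code (rep c) = c.1 := fun c => c.2.choose_spec
  obtain ⟨z₀, hz₀⟩ := hz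
  have : Nonempty C := ⟨⟨code z₀, z₀, hz₀, rfl⟩⟩
  obtain ⟨c, hc⟩ := Finite.exists_min fun c : C => costGS P S ⟨(rep c).x, Y (rep c).x⟩
  refine ⟨⟨(rep c).x, Y (rep c).x⟩, (hY _ (hrep c).1).1, fun z' hz' => ?_⟩
  have hx : (rep ⟨code z', z', hz', rfl⟩).x = z'.x := by
    obtain ⟨h1, h2⟩ := hrep ⟨code z', z', hz', rfl⟩
    generalize rep ⟨code z', z', hz', rfl⟩ = w at h1 h2
    funext k e
    by_cases he : e ∈ (GS P S).arcs
    · have h3 : w.x k e = 1 ↔ z'.x k e = 1 := iff_of_eq (congrFun (congrFun h2 k) ⟨e, he⟩)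
      have h4 := (h1.1 k).1 e
      have h5 := (hz'.1 k).1 e
      omega
    · have he' : e ∉ (GSk P S k).arcs := fun h => he (restrict_arcs_subset h)
      rw [(h1.1 k).2.1 e he', (hz'.1 k).2.1 e he']
  have h4 := hc ⟨code z', z', hz', rfl⟩
  rw [hx] at h4
  exact h4.trans (hY z' hz').2

theorem mem_GSk_of_trajectories {z : Solution (AuxNode P) N K} {Q : K → List (TArc (AuxNode P))}
    (hz : FeasibleGS P S z) (hQ : TrajectoriesOf P S z.x Q) {k : K} {e : TArc (AuxNode P)}
    (he : e ∈ Q k) : e ∈ (GSk P S k).arcs := by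
  by_contra h
  have h1 := ((hQ k).2 e).1 he
  rw [(hz.1 k).2.1 e h] at h1
  exact zero_ne_one h1

/-- The flow of an optimal solution of SND-RR(`G_S`) consists of trajectories. -/
theorem exists_trajectories (hS : initialNodes P ⊆ S) {z : Solution (AuxNode P) N K}
    (hz : OptimalGS P S z) : ∃ Q, TrajectoriesOf P S z.x Q := by
  classical
  have h0 : ∀ n, (n, 0) ∈ S := fun n => hS (by simp [initialNodes])
  have hsnk : ∀ k, sink P k ∈ S := fun k => hS (by simp [initialNodes])
  have hT := truckSystem_GS h0
  have h : ∀ k, ∃ L, IsTrajectory (GSk P S k) (source P k) (sink P k) L ∧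
      ∀ e ∈ L, z.x k e = 1 := fun k =>
    (hz.1.1 k).exists_trajectory (GSk_closed P S k)
      (mem_restrict_nodes.2 ⟨hsnk k, auxDest_mem P k⟩) (source_ne_sink P k)
  choose L hL hx using h
  have hle : ∀ k e, indicator (L k) e ≤ z.x k e := by
    intro k e
    by_cases he : e ∈ L k
    · rw [hx k e he, indicator_eq_one.2 he]
    · simp [indicator, he]
  have hflow : ∀ k, IsUnitFlow (GSk P S k) (source P k) (sink P k) (indicator (L k)) := fun k =>
    (hL k).walk.isUnitFlow (source_ne_sink P k) (hL k).nodup (hL k).1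
  -- Keeping only the paths lowers loads and durations, so the same trucks suffice. Optimality of
  -- `z` then says that nothing was saved, hence that no movement was discarded.
  have hfeas : FeasibleGS P S ⟨fun k => indicator (L k), z.y⟩ := by
    refine ⟨hflow, fun a ha => (TruckSystem.load_mono hle).trans (hz.1.2.1 a ha), fun k => ?_⟩
    refine le_trans (Finset.sum_le_sum fun e _ => ?_) (hz.1.2.2 k)
    exact mul_le_mul_of_nonneg_left (by exact_mod_cast hle k _) (Nat.cast_nonneg _)
  have hcost := hz.2 _ hfeas
  have hvar : variableCost I (proj P) (GS P S).move z.x ≤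
      variableCost I (proj P) (GS P S).move (fun k => indicator (L k)) :=
    le_of_add_le_add_left hcost
  refine ⟨L, fun k => ⟨⟨fun e he => restrict_arcs_subset ((hL k).1 e he), (hL k).2⟩, fun e =>
    ⟨hx k e, (hz.1.1 k).mem_of_eq_one (hflow k) (hx k) (fun e he => ?_)
      (fun e he => partialNetwork_hold_lt e (mem_restrict_hold.1 he).1) (GSk_closed P S k) e⟩⟩⟩
  have hmem : Sum.inl e ∈ (GSk P S k).arcs := by
    by_contra h
    rw [(hz.1.1 k).2.1 _ h] at he
    exact zero_ne_one he
  have := hT.eq_of_variableCost_le hle hvar (k := k)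
    (mem_restrict_move.1 (Network.inl_mem_arcs.1 hmem)).1
  rw [he] at this
  exact indicator_eq_one.1 this.symm

end Formulations

/-! ### Trajectories of a lower bound solution, retiming and refinement -/

section Formulations

variable {N K : Type*} [Fintype K] [Fintype N] [DecidableEq N] {I : Instance N K}
  {P : ValidPartition I} {S : Finset (TNode (AuxNode P))}
  {z : Solution (AuxNode P) N K} {Q : K → List (TArc (AuxNode P))}

theorem flow_eq_indicator (hz : FeasibleGS P S z) (hQ : TrajectoriesOf P S z.x Q) (k : K) :
    z.x k = indicator (Q k) := by
  funext e
  by_cases he : e ∈ Q k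
  · rw [indicator_eq_one.2 he, ((hQ k).2 e).1 he]
  · have h1 := ((hz.1 k).1 e).resolve_right fun h => he (((hQ k).2 e).2 h)
    simp [indicator, he, h1]

theorem arc_mem_moves (s : Traversal Q) : s.arc ∈ moves (Q s.1) := List.get_mem _ _

theorem traversal_mem (hz : FeasibleGS P S z) (hQ : TrajectoriesOf P S z.x Q) (s : Traversal Q) :
    s.arc ∈ (GS P S).move ∧ (s.arc.1.1, s.arc.2.1) ∈ auxKArcs P s.1 := by
  have := mem_GSk_of_trajectories hz hQ (mem_moves.1 (arc_mem_moves s))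
  exact mem_restrict_move.1 (Network.inl_mem_arcs.1 this)

/-- This is the duration constraint read along the trajectory. It lets a commodity travel without
waiting and still meet its deadline. -/
theorem transit_le (hz : FeasibleGS P S z) (hQ : TrajectoriesOf P S z.x Q) (k : K) :
    I.r k + ((moves (Q k)).map fun e => I.τ (baseArc (proj P) e)).sum ≤ I.l k := by
  have h1 := hz.2.2 k
  rw [flow_eq_indicator hz hQ k, sum_move_indicator _ (hQ k).1.nodup
    (fun e he => mem_GSk_of_trajectories hz hQ he) fun e => (I.τ (baseArc (proj P) e) : ℤ)] at h1
  have h3 : ((moves (Q k)).map fun e => (I.τ (baseArc (proj P) e) : ℤ)).sum =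
      (((moves (Q k)).map fun e => I.τ (baseArc (proj P) e)).sum : ℕ) := by
    rw [Nat.cast_list_sum, List.map_map]
    rfl
  rw [h3] at h1
  omega

theorem trajectory_moves_spec (hQ : TrajectoriesOf P S z.x Q) (k : K) :
    0 < (moves (Q k)).length ∧
    (∀ p : Fin (moves (Q k)).length, p.val = 0 →
      (source P k).1 = (Traversal.arc ⟨k, p⟩).1.1 ∧ (source P k).2 ≤ (Traversal.arc ⟨k, p⟩).1.2) ∧
    (∀ p p' : Fin (moves (Q k)).length, p'.val = p.val + 1 →
      (Traversal.arc ⟨k, p⟩).2.1 = (Traversal.arc ⟨k, p'⟩).1.1 ∧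
        (Traversal.arc ⟨k, p⟩).2.2 ≤ (Traversal.arc ⟨k, p'⟩).1.2) ∧
    (∀ p : Fin (moves (Q k)).length, p.val + 1 = (moves (Q k)).length →
      (Traversal.arc ⟨k, p⟩).2.1 = (sink P k).1 ∧ (Traversal.arc ⟨k, p⟩).2.2 ≤ (sink P k).2) := by
  obtain ⟨h0, h1, h2, h3⟩ := (hQ k).1.walk.moves_spec fun e he => by
    have := mem_partialNetwork_hold.1 (Network.inr_mem_arcs.1 ((hQ k).1.1 _ he))
    exact ⟨this.2.1, this.2.2.1.le⟩
  refine ⟨?_, fun p hp => h1 p p.2 hp, fun p p' hp => h2 p p' p.2 p'.2 hp, fun p hp => h3 p p.2 hp⟩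
  rw [List.length_pos_iff]
  exact fun h => auxOrigin_ne P k (h0 h).1

theorem eq_of_mem_KF {k : K} (hk : k ∈ KF P S z.x) (hz : FeasibleGS P S z)
    (hQ : TrajectoriesOf P S z.x Q) (p : Fin (moves (Q k)).length) :
    (Traversal.arc ⟨k, p⟩).2.2 = (Traversal.arc ⟨k, p⟩).1.2 +
      I.τ (baseArc (proj P) (Traversal.arc ⟨k, p⟩)) := by
  simp only [KF, Finset.mem_filter] at hk
  refine hk.2 _ (traversal_mem hz hQ ⟨k, p⟩).1 ?_
  rw [((hQ k).2 _).1 (mem_moves.1 (arc_mem_moves ⟨k, p⟩))]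
  exact one_pos

/-! ### The linear program -/

/-- The least feasible values of the variables `δ` for given departure times. -/
def timeGap (t : Traversal Q → ℝ) (_ : N × N) (s s' : Traversal Q) : ℝ := |t s - t s'|

/-- Integral feasible departure times exist. -/
theorem exists_feasibleLP (hz : FeasibleGS P S z) (hQ : TrajectoriesOf P S z.x Q) :
    ∃ t : Traversal Q → ℕ, FeasibleLP P S z.x Q (fun s => (t s : ℝ))
      (timeGap fun s => (t s : ℝ)) := by
  classical
  let t : Traversal Q → ℕ := fun s => if s.1 ∈ KF P S z.x then s.arc.1.2 else
    I.r s.1 + (((moves (Q s.1)).map fun e => I.τ (baseArc (proj P) e)).take s.2).sum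
  have ht : ∀ k (p : Fin (moves (Q k)).length), k ∉ KF P S z.x →
      t ⟨k, p⟩ + I.τ (baseArc (proj P) (Traversal.arc ⟨k, p⟩)) =
        I.r k + (((moves (Q k)).map fun e => I.τ (baseArc (proj P) e)).take (p + 1)).sum := by
    intro k p hk
    simp only [t, if_neg hk]
    rw [List.sum_take_succ _ _ (by simp), ← add_assoc]
    simp [Traversal.arc]
  refine ⟨t, ⟨fun k p p' hp => ?_, fun k p hp => ?_, fun k p hp => ?_, fun b hb s hs => ?_,
    fun b hb s hs => ?_, fun s hs => ?_⟩⟩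
  · norm_cast
    by_cases hk : k ∈ KF P S z.x
    · have h1 := eq_of_mem_KF hk hz hQ p
      have h2 := ((trajectory_moves_spec hQ k).2.2.1 p p' hp).2
      simp only [t, if_pos hk]
      omega
    · rw [ht k p hk]
      simp only [t, if_neg hk, hp]
      exact le_rfl
  · norm_cast
    by_cases hk : k ∈ KF P S z.x
    · simp only [t, if_pos hk]
      exact ((trajectory_moves_spec hQ k).2.1 p hp).2
    · simp only [t, if_neg hk]
      omega
  · norm_cast
    by_cases hk : k ∈ KF P S z.x
    · have h1 := eq_of_mem_KF hk hz hQ p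
      have h2 : _ ≤ I.l k := ((trajectory_moves_spec hQ k).2.2.2 p hp).2
      simp only [t, if_pos hk]
      omega
    · rw [ht k p hk, List.take_of_length_le (by simp; omega)]
      exact transit_le hz hQ k
  · exact le_abs_self _
  · rw [← neg_sub]
    exact neg_le_abs _
  · simp [t, if_pos hs]

/-- Needed so that the rounded departure times are natural numbers. -/
theorem FeasibleLP.nonneg {x : K → TArc (AuxNode P) → ℕ} {t : Traversal Q → ℝ}
    {δ : N × N → Traversal Q → Traversal Q → ℝ} (h : FeasibleLP P S x Q t δ) (k : K) (i : ℕ) :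
    ∀ hi : i < (moves (Q k)).length, 0 ≤ t ⟨k, ⟨i, hi⟩⟩ := by
  induction i with
  | zero => exact fun hi => (Nat.cast_nonneg _).trans (h.release k ⟨0, hi⟩ rfl)
  | succ i ih =>
    intro hi
    refine (ih (by omega)).trans (le_trans ?_ (h.transit k ⟨i, by omega⟩ ⟨i + 1, hi⟩ rfl))
    exact le_add_of_nonneg_right (Nat.cast_nonneg _)

/-- The deadline propagates backwards from the last movement. This keeps all retimed movements
within the horizon of `G_T`. -/
theorem FeasibleLP.arrival_le {x : K → TArc (AuxNode P) → ℕ} {t : Traversal Q → ℝ}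
    {δ : N × N → Traversal Q → Traversal Q → ℝ} (h : FeasibleLP P S x Q t δ) (k : K)
    (p : Fin (moves (Q k)).length) :
    t ⟨k, p⟩ + (I.τ (baseArc (proj P) (Traversal.arc ⟨k, p⟩)) : ℝ) ≤ (I.l k : ℝ) := by
  obtain ⟨p, hp⟩ := p
  obtain ⟨m, hm⟩ : ∃ m, m + p + 1 = (moves (Q k)).length :=
    ⟨(moves (Q k)).length - (p + 1), by omega⟩
  induction m generalizing p with
  | zero => exact h.deadline k ⟨p, hp⟩ (by simpa using hm)
  | succ m ih =>
    refine (h.transit k ⟨p, hp⟩ ⟨p + 1, by omega⟩ rfl).trans (le_trans ?_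
      (ih (p + 1) (by omega) (by omega)))
    exact le_add_of_nonneg_right (Nat.cast_nonneg _)

theorem FeasibleLP.timeGap_le {x : K → TArc (AuxNode P) → ℕ} {t : Traversal Q → ℝ}
    {δ : N × N → Traversal Q → Traversal Q → ℝ} (h : FeasibleLP P S x Q t δ) :
    costLP P S Q (timeGap t) ≤ costLP P S Q δ :=
  Finset.sum_le_sum fun b hb => Finset.sum_le_sum fun s hs =>
    abs_sub_le_iff.2 ⟨h.consolidate b hb s hs, h.consolidate' b hb s hs⟩

/-- Departure times can be made integral without increasing the cost. -/
theorem FeasibleLP.exists_integral {x : K → TArc (AuxNode P) → ℕ} {t : Traversal Q → ℝ}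
    {δ : N × N → Traversal Q → Traversal Q → ℝ} (h : FeasibleLP P S x Q t δ) :
    ∃ t' : Traversal Q → ℕ, FeasibleLP P S x Q (fun s => (t' s : ℝ))
      (timeGap fun s => (t' s : ℝ)) ∧
      costLP P S Q (timeGap fun s => (t' s : ℝ)) ≤ costLP P S Q δ := by
  -- One threshold serves all traversals at once, so constraints between different departure times
  -- survive the rounding.
  obtain ⟨θ, hθ0, hθ1, hθ⟩ := exists_floor_sum_le (I.arcs.sigma (J P S Q))
    (fun i => t i.2.1) (fun i => t i.2.2)
  let t' : Traversal Q → ℕ := fun s => ⌊t s + θ⌋.toNat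
  have ht' : ∀ s, (t' s : ℝ) = (⌊t s + θ⌋ : ℝ) := by
    rintro ⟨k, p, hp⟩
    have h0 : 0 ≤ ⌊t ⟨k, ⟨p, hp⟩⟩ + θ⌋ := Int.floor_nonneg.2 (add_nonneg (h.nonneg k p hp) hθ0)
    have : ((t' ⟨k, ⟨p, hp⟩⟩ : ℤ)) = ⌊t ⟨k, ⟨p, hp⟩⟩ + θ⌋ := Int.toNat_of_nonneg h0
    exact_mod_cast this
  have hle : ∀ (a b : ℝ) (n : ℕ), a + n ≤ b → (⌊a + θ⌋ : ℝ) + n ≤ (⌊b + θ⌋ : ℝ) := by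
    intro a b n hab
    have : ⌊a + θ⌋ + (n : ℤ) ≤ ⌊b + θ⌋ := by
      rw [← Int.floor_add_natCast]
      exact Int.floor_mono (by linarith)
    exact_mod_cast this
  -- Integral bounds and fixed departure times do not move, because `0 ≤ θ < 1`.
  have hnat : ∀ n : ℕ, ⌊(n : ℝ) + θ⌋ = n := by
    intro n
    rw [Int.floor_eq_iff]
    constructor
    · push_cast
      linarith
    · push_cast
      linarith
  refine ⟨t', ⟨fun k p p' hp => ?_, fun k p hp => ?_, fun k p hp => ?_, fun b hb s hs => ?_,
    fun b hb s hs => ?_, fun s hs => ?_⟩, ?_⟩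
  · rw [ht', ht']
    exact hle _ _ _ (h.transit k p p' hp)
  · rw [ht']
    have := hle (I.r k) _ 0 (by simpa using h.release k p hp)
    rw [hnat] at this
    simpa using this
  · rw [ht']
    have := hle _ _ _ (h.deadline k p hp)
    rwa [hnat] at this
  · exact le_abs_self _
  · rw [← neg_sub]
    exact neg_le_abs _
  · rw [ht', h.fixed s hs, hnat]
    rfl
  · refine le_trans ?_ h.timeGap_le
    simp only [costLP, timeGap, ht']
    rw [Finset.sum_sigma, Finset.sum_sigma] at hθ
    exact hθ

/-- The linear program has an optimal solution with integral departure times. -/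
theorem exists_optimalLP (hz : FeasibleGS P S z) (hQ : TrajectoriesOf P S z.x Q) :
    ∃ (t : Traversal Q → ℕ) (δ : N × N → Traversal Q → Traversal Q → ℝ),
      OptimalLP P S z.x Q (fun s => (t s : ℝ)) δ := by
  classical
  -- On integral times the objective is a natural number, so a minimum exists by well-ordering.
  -- Every real solution is matched by an integral one that is no worse.
  let c : (Traversal Q → ℕ) → ℕ := fun t =>
    ∑ b ∈ I.arcs, ∑ s ∈ J P S Q b, ((t s.1 : ℤ) - (t s.2 : ℤ)).natAbs
  have hc : ∀ t : Traversal Q → ℕ, costLP P S Q (timeGap fun s => (t s : ℝ)) = (c t : ℝ) := by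
    intro t
    simp only [costLP, timeGap, c, Nat.cast_sum]
    refine Finset.sum_congr rfl fun b _ => Finset.sum_congr rfl fun s _ => ?_
    rw [Nat.cast_natAbs]
    push_cast
    rfl
  have hex : ∃ n, ∃ t : Traversal Q → ℕ, FeasibleLP P S z.x Q (fun s => (t s : ℝ))
      (timeGap fun s => (t s : ℝ)) ∧ c t = n := by
    obtain ⟨t, ht⟩ := exists_feasibleLP hz hQ
    exact ⟨c t, t, ht, rfl⟩
  obtain ⟨t, ht, htn⟩ := Nat.find_spec hex
  refine ⟨t, _, ht, fun t' δ' h' => ?_⟩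
  obtain ⟨t'', ht'', hle⟩ := h'.exists_integral
  refine le_trans ?_ hle
  rw [hc, hc, htn]
  exact_mod_cast Nat.find_min' hex ⟨t'', ht'', rfl⟩

/-! ### The upper bound procedure -/

theorem exists_solutionOfTimes (hz : FeasibleGS P S z) (hQ : TrajectoriesOf P S z.x Q)
    {t : Traversal Q → ℕ} {δ : N × N → Traversal Q → Traversal Q → ℝ}
    (ht : FeasibleLP P S z.x Q (fun s => (t s : ℝ)) δ) :
    ∃ zbar, SolutionOfTimes P Q t zbar := by
  classical
  have h : ∀ k, ∃ L, Walk (source P k) (sink P k) L ∧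
      moves L = List.ofFn (fun p : Fin (moves (Q k)).length =>
        (((Traversal.arc ⟨k, p⟩).1.1, t ⟨k, p⟩), ((Traversal.arc ⟨k, p⟩).2.1,
          t ⟨k, p⟩ + I.τ (baseArc (proj P) (Traversal.arc ⟨k, p⟩))))) ∧
      ∀ e ∈ L, e ∈ (GTk P k).arcs := by
    intro k
    obtain ⟨hpos, hfirst, hstep, hlast⟩ := trajectory_moves_spec hQ k
    have hT := le_T I k
    have harr : ∀ p : Fin (moves (Q k)).length,
        t ⟨k, p⟩ + I.τ (baseArc (proj P) (Traversal.arc ⟨k, p⟩)) ≤ I.l k := fun p => by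
      exact_mod_cast ht.arrival_le k p
    have hmem := fun p : Fin (moves (Q k)).length => traversal_mem hz hQ ⟨k, p⟩
    refine exists_walk_of_moves _ hpos (fun p => ?_) (fun p hp => ?_) (fun p p' hp => ?_)
      (fun p hp => ?_)
    · have := harr p
      refine mem_restrict_move.2 ⟨mem_fullNetwork_move.2 ⟨?_, ?_,
        mem_auxArcs_of_auxKArcs (hmem p).2, rfl⟩, (hmem p).2⟩
      · dsimp only
        omega
      · dsimp only
        omega
    · have h1 := harr p
      have h2 : I.r k ≤ t ⟨k, p⟩ := by exact_mod_cast ht.release k p hp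
      dsimp only
      rw [← (hfirst p hp).1]
      exact holdReach_fullNetwork (auxOrigin_mem P k) h2 (by omega)
    · have h1 := harr p'
      have h2 : t ⟨k, p⟩ + I.τ (baseArc (proj P) (Traversal.arc ⟨k, p⟩)) ≤ t ⟨k, p'⟩ := by
        exact_mod_cast ht.transit k p p' hp
      dsimp only
      rw [(hstep p p' hp).1]
      exact holdReach_fullNetwork (auxKArcs_ends _ (hmem p').2).1 h2 (by omega)
    · dsimp only
      rw [(hlast p hp).1]
      exact holdReach_fullNetwork (auxDest_mem P k) (harr p) hT
  choose L hw hmv hL using h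
  refine ⟨⟨fun k => indicator (L k), fun a =>
    ⌈load I (copiesT P a) (fun k => indicator (L k)) / (I.u (baseArc id a) : ℝ)⌉₊⟩,
    ⟨L, fun k => ⟨(hw k).isTrajectory (source_ne_sink P k)
      (fun e he => restrict_arcs_subset (hL k e he))
      ((hw k).nodup_of_time fun e he => GTk_time (hL k e he)).1, hmv k, fun e => ?_⟩⟩, fun a => rfl⟩
  by_cases he : e ∈ L k <;> simp [indicator, he]

/-- The upper bound procedure can be carried out. -/
theorem exists_upperBound (hz : FeasibleGS P S z) (hQ : TrajectoriesOf P S z.x Q) :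
    ∃ zbar C, UpperBound P S z.x Q zbar C := by
  classical
  obtain ⟨t, δ, hopt⟩ := exists_optimalLP hz hQ
  obtain ⟨zbar, hzbar⟩ := exists_solutionOfTimes hz hQ hopt.1
  refine ⟨zbar, Finset.univ.filter fun k => k ∉ KF P S z.x ∧
    ∃ b ∈ I.arcs, ∃ s ∈ J P S Q b, s.1.1 = k ∧ 0 < δ b s.1 s.2, t, δ, hopt, hzbar, fun k => ?_⟩
  simp

/-- The solution returned by the upper bound procedure is given by walks in `G_T`. -/
theorem SolutionOfTimes.exists_walks (hz : FeasibleGS P S z) (hQ : TrajectoriesOf P S z.x Q)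
    {t : Traversal Q → ℕ} {zbar : Solution (AuxNode P) N K} (h : SolutionOfTimes P Q t zbar) :
    ∃ L : K → List (TArc (AuxNode P)), (∀ k, Walk (source P k) (sink P k) (L k)) ∧
      (∀ k, ∀ e ∈ L k, e ∈ (GTk P k).arcs) ∧ (∀ k, zbar.x k = indicator (L k)) ∧
      (∀ a ∈ I.DT.move, zbar.y a = planTrucks I (planOf (proj P) L) (key id a)) ∧
      ∀ k, planOf (proj P) L k = List.ofFn fun p : Fin (moves (Q k)).length =>
        (baseArc (proj P) (Traversal.arc ⟨k, p⟩), t ⟨k, p⟩) := by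
  obtain ⟨⟨L, hL⟩, hy⟩ := h
  have hx : ∀ k, zbar.x k = indicator (L k) := fun k => by
    funext e
    rw [(hL k).2.2 e]
    by_cases he : e ∈ L k <;> simp [indicator, he]
  refine ⟨L, fun k => (hL k).1.walk, fun k => ?_, hx, fun a ha => ?_, fun k => ?_⟩
  -- The trajectory is only required to lie in `G_T`. Its movements are over designated arcs and
  -- storage stays at a node, so all of it is over the designated subgraph.
  · refine (hL k).1.walk.mem_restrict fullNetwork_hold_fst auxKArcs_ends (hL k).1.1
      (fun e he => ?_) (auxOrigin_mem P k)
    rw [(hL k).2.1] at he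
    obtain ⟨p, rfl⟩ := List.mem_ofFn.1 he
    exact (traversal_mem hz hQ ⟨k, p⟩).2
  · have hxx : zbar.x = fun k => indicator (L k) := funext hx
    rw [hy a, hxx, (truckSystem_GT P).load_indicator (fun k => (hL k).1.nodup)
      (fun k => (hL k).1.1) ha]
    rfl
  · rw [planOf, (hL k).2.1, List.map_ofFn]
    rfl

/-- If no commodity is selected for refinement, then consolidated movements stay consolidated. -/
theorem times_eq_of_key_eq (hS : ∀ n, (n, 0) ∈ S) (hz : FeasibleGS P S z)
    (hQ : TrajectoriesOf P S z.x Q) {t : Traversal Q → ℕ}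
    {δ : N × N → Traversal Q → Traversal Q → ℝ}
    (ht : FeasibleLP P S z.x Q (fun s => (t s : ℝ)) δ)
    (hC : ¬ ∃ k, k ∉ KF P S z.x ∧ ∃ b ∈ I.arcs, ∃ s ∈ J P S Q b, s.1.1 = k ∧ 0 < δ b s.1 s.2)
    {s s' : Traversal Q} (h : key (proj P) s.arc = key (proj P) s'.arc) : t s = t s' := by
  have hT := truckSystem_GS hS
  obtain ⟨a, ha, hak⟩ := hT.exists_rep _ (traversal_mem hz hQ s).1
  have hb := hT.base_mem a ha
  have hs : s.arc ∈ copiesS P S a := (hT.mem_copies a ha _).2 ⟨(traversal_mem hz hQ s).1, hak.symm⟩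
  have hs' : s'.arc ∈ copiesS P S a :=
    (hT.mem_copies a ha _).2 ⟨(traversal_mem hz hQ s').1, h.symm.trans hak.symm⟩
  -- The first member of a pair decides about selection. Since `J` contains both orders, it is
  -- enough that one of the two commodities has a short arc.
  have key1 : ∀ s s' : Traversal Q, s.arc ∈ copiesS P S a → s'.arc ∈ copiesS P S a →
      s.1 ∉ KF P S z.x → t s = t s' := by
    intro s s' hs hs' hk
    have hJ : (s, s') ∈ J P S Q (baseArc id a) := by
      simp only [J, Finset.mem_filter, Finset.mem_univ, true_and]
      exact ⟨a, ha, rfl, hs, hs'⟩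
    have h0 : δ (baseArc id a) s s' ≤ 0 := not_lt.1 fun h0 =>
      hC ⟨s.1, hk, _, hb, (s, s'), hJ, rfl, h0⟩
    have h1 : (t s : ℝ) - t s' ≤ δ (baseArc id a) s s' := ht.consolidate _ hb _ hJ
    have h2 : (t s' : ℝ) - t s ≤ δ (baseArc id a) s s' := ht.consolidate' _ hb _ hJ
    have : (t s : ℝ) = t s' := by linarith
    exact_mod_cast this
  by_cases h1 : s.1 ∈ KF P S z.x
  · by_cases h2 : s'.1 ∈ KF P S z.x
    · have e1 := ht.fixed s h1
      have e2 := ht.fixed s' h2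
      have e3 : s.arc.1.2 = s'.arc.1.2 := (Prod.ext_iff.1 h).2
      rw [e3, ← e2] at e1
      exact_mod_cast e1
    · exact (key1 s' s hs' hs h2).symm
  · exact key1 s s' hs hs' h1

/-- The optimal value of SND-RR(`G_S`) is a lower bound for SND-RR(`G_T`). -/
theorem costGS_le_costGT (hS : initialNodes P ⊆ S) (hz : OptimalGS P S z)
    {z' : Solution (AuxNode P) N K} (hz' : FeasibleGT P z') : costGS P S z ≤ costGT P z' := by
  obtain ⟨L, hw, hL, hc⟩ := exists_walks_of_feasibleGT P hz'
  obtain ⟨z'', h1, h2⟩ := exists_GS_of_walks_GT hS hw hL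
  exact (hz.2 z'' h1).trans (h2.trans hc)

/-- If the costs differ, then some commodity is selected for refinement. -/
theorem nonempty_of_cost_ne (hS : initialNodes P ⊆ S) (hz : OptimalGS P S z)
    (hQ : TrajectoriesOf P S z.x Q) {zbar : Solution (AuxNode P) N K} {C : Finset K}
    (hub : UpperBound P S z.x Q zbar C) (hne : costGT P zbar ≠ costGS P S z) : C.Nonempty := by
  classical
  by_contra hemp
  rw [Finset.not_nonempty_iff_eq_empty] at hemp
  subst hemp
  have h0 : ∀ n, (n, 0) ∈ S := fun n => hS (by simp [initialNodes])
  obtain ⟨t, δ, hopt, hsol, hC⟩ := hub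
  have hC' : ¬ ∃ k, k ∉ KF P S z.x ∧
      ∃ b ∈ I.arcs, ∃ s ∈ J P S Q b, s.1.1 = k ∧ 0 < δ b s.1 s.2 := by
    rintro ⟨k, hk⟩
    exact absurd ((hC k).2 hk) (Finset.notMem_empty k)
  obtain ⟨L, hw, hL, hx, hy, hplan⟩ := hsol.exists_walks hz.1 hQ
  obtain ⟨hfeas, hcost⟩ := walks_GT hw hL hx hy
  refine hne (le_antisymm ?_ (costGS_le_costGT hS hz hfeas))
  have hT := truckSystem_GS h0
  have hQm : ∀ k, ∀ e ∈ Q k, e ∈ (GS P S).arcs := fun k e he => (hQ k).1.1 e he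
  have h1 : planCost I (planOf (proj P) Q) ≤ costGS P S z :=
    hT.planCost_le (fun k => (hQ k).1.nodup) hQm (fun k e he => ((hQ k).2 e).1 he) hz.1.2.1
  rw [hcost]
  refine le_trans ?_ h1
  -- The map sends departure times in `Q` to the new ones. By `times_eq_of_key_eq` the chosen
  -- traversal is irrelevant, so the new plan is the image of the old plan under one map of keys.
  let g : (N × N) × ℕ → (N × N) × ℕ := fun κ =>
    if h : ∃ s : Traversal Q, key (proj P) s.arc = κ then (κ.1, t h.choose) else κ
  refine planCost_le_of_sublist_map I g (fun κ => ?_) (fun k => ?_) (hT.planOf_arc_mem hQm)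
  · simp only [g]
    split_ifs <;> rfl
  · have heq : planOf (proj P) L k = (planOf (proj P) Q k).map g := by
      rw [hplan k, planOf, List.map_map]
      conv_rhs => rw [← List.ofFn_get (moves (Q k)), List.map_ofFn]
      congr 1
      funext p
      have h : ∃ s : Traversal Q, key (proj P) s.arc =
          key (proj P) (Traversal.arc (⟨k, p⟩ : Traversal Q)) := ⟨_, rfl⟩
      have h2 : g (key (proj P) (Traversal.arc (⟨k, p⟩ : Traversal Q))) =
          (baseArc (proj P) (Traversal.arc (⟨k, p⟩ : Traversal Q)), t h.choose) := dif_pos h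
      have h3 := times_eq_of_key_eq h0 hz.1 hQ hopt.1 hC' h.choose_spec
      rw [h3] at h2
      exact h2.symm
    rw [heq]

/-- If the costs agree, then the output is optimal. -/
theorem optimal_of_cost_eq (hS : initialNodes P ⊆ S) (hz : OptimalGS P S z)
    (hQ : TrajectoriesOf P S z.x Q) {zbar : Solution (AuxNode P) N K} {C : Finset K}
    (hub : UpperBound P S z.x Q zbar C) (heq : costGT P zbar = costGS P S z) :
    OptimalGT P zbar ∧ I.OptimalDT (project P zbar) ∧
      I.costDT (project P zbar) = costGT P zbar := by
  obtain ⟨t, δ, hopt, hsol, hC⟩ := hub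
  obtain ⟨L, hw, hL, hx, hy, hplan⟩ := hsol.exists_walks hz.1 hQ
  obtain ⟨hfeas, hcost⟩ := walks_GT hw hL hx hy
  obtain ⟨hfeas', hcost'⟩ := project_walks hw hL hx hy
  refine ⟨⟨hfeas, fun z' hz' => heq ▸ costGS_le_costGT hS hz hz'⟩, ⟨hfeas', fun z' hz' => ?_⟩,
    hcost'.trans hcost.symm⟩
  rw [hcost', ← hcost, heq]
  obtain ⟨L', hw', hL', hc⟩ := exists_GT_of_feasibleDT P hz'
  obtain ⟨z'', h1, h2⟩ := exists_GS_of_walks_GT hS hw' hL'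
  exact (hz.2 z'' h1).trans (h2.trans hc)

/-! ### Refinement -/

theorem exists_earliestShort (hz : FeasibleGS P S z) (hQ : TrajectoriesOf P S z.x Q) {k : K}
    (hk : k ∉ KF P S z.x) : ∃ e, EarliestShort P (Q k) e := by
  classical
  simp only [KF, Finset.mem_filter, Finset.mem_univ, true_and] at hk
  push Not at hk
  obtain ⟨e, he, hpos, hne⟩ := hk
  have heQ : e ∈ moves (Q k) := by
    rw [mem_moves, (hQ k).2]
    have := (hz.1 k).1 (Sum.inl e)
    omega
  -- Arcs of a partial network never arrive late, so an arc with the wrong transit time is short.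
  have hshort : IsShort P e := lt_of_le_of_ne (mem_partialNetwork_move.1 he).2.2.2.1 hne
  obtain ⟨e', he', hmin⟩ := Finset.exists_min_image
    ((moves (Q k)).toFinset.filter fun e => IsShort P e) (fun e => e.1.2)
    ⟨e, Finset.mem_filter.2 ⟨List.mem_toFinset.2 heQ, hshort⟩⟩
  obtain ⟨h1, h2⟩ := Finset.mem_filter.1 he'
  exact ⟨e', List.mem_toFinset.1 h1, h2, fun e'' h3 h4 =>
    hmin e'' (Finset.mem_filter.2 ⟨List.mem_toFinset.2 h3, h4⟩)⟩

/-- The refinement step can be carried out. -/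
theorem exists_refines (hz : FeasibleGS P S z) (hQ : TrajectoriesOf P S z.x Q)
    {zbar : Solution (AuxNode P) N K} {C : Finset K} (hub : UpperBound P S z.x Q zbar C) :
    ∃ S', Refines P S Q C S' := by
  classical
  obtain ⟨t, δ, -, -, hC⟩ := hub
  have h : ∀ k, ∃ e : TPair (AuxNode P), k ∈ C → EarliestShort P (Q k) e := by
    intro k
    by_cases hk : k ∈ C
    · obtain ⟨e, he⟩ := exists_earliestShort hz hQ ((hC k).1 hk).1
      exact ⟨e, fun _ => he⟩
    · exact ⟨((auxOrigin P k, 0), (auxOrigin P k, 0)), fun h => absurd h hk⟩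
  choose e he using h
  exact ⟨_, e, he, rfl⟩

/-- A refinement step adds new timed nodes within the time horizon. -/
theorem Refines.card_lt (hQ : TrajectoriesOf P S z.x Q)
    {C : Finset K} {S' : Finset (TNode (AuxNode P))} (hC : C.Nonempty) (h : Refines P S Q C S') :
    S ⊆ S' ∧ S.card < S'.card ∧ ((∀ p ∈ S, p.2 ≤ I.T) → ∀ p ∈ S', p.2 ≤ I.T) := by
  classical
  obtain ⟨e, he, rfl⟩ := h
  have hnew : ∀ k ∈ C, ((e k).2.1, (e k).1.2 + I.τ (baseArc (proj P) (e k))) ∉ S ∧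
      (e k).1.2 + I.τ (baseArc (proj P) (e k)) ≤ I.T := by
    intro k hk
    obtain ⟨h1, h2, -⟩ := he k hk
    have h3 := Network.inl_mem_arcs.1 ((hQ k).1.1 _ (mem_moves.1 h1))
    obtain ⟨-, -, h4, -, h5⟩ := mem_partialNetwork_move.1 h3
    -- Had the true arrival node been in `S`, the arc would have ended there instead of being short.
    exact ⟨fun hmem => absurd (h5 _ hmem le_rfl) (not_le.2 h2), h4⟩
  refine ⟨Finset.subset_union_left, ?_, fun hS p hp => ?_⟩
  · obtain ⟨k, hk⟩ := hC
    refine Finset.card_lt_card (Finset.ssubset_iff_subset_ne.2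
      ⟨Finset.subset_union_left, fun heq => (hnew k hk).1 ?_⟩)
    rw [heq]
    simp only [Finset.mem_union, Finset.mem_image]
    exact Or.inr ⟨k, hk, rfl⟩
  · simp only [Finset.mem_union, Finset.mem_image] at hp
    rcases hp with hp | ⟨k, hk, rfl⟩
    · exact hS p hp
    · exact (hnew k hk).2

end Formulations

/-! ### Counting iterations and the invariant of the algorithm -/

section Formulations

variable {N K : Type*} [Fintype K] [Fintype N] [DecidableEq N] {I : Instance N K}
  {P : ValidPartition I}

/-- Feasibility yields a walk in `G_T` from source to sink. It is nonempty, and each of its arcs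
moves forward in time. -/
theorem release_lt_deadline (P : ValidPartition I) (hfeas : ∃ z, I.FeasibleDT z) (k : K) :
    I.r k < I.l k := by
  obtain ⟨z, hz⟩ := hfeas
  obtain ⟨L, hw, hL, -⟩ := exists_GT_of_feasibleDT P hz
  have h1 := hw k
  have h2 := hL k
  cases hLk : L k with
  | nil =>
    rw [hLk] at h1
    exact absurd h1 (source_ne_sink P k)
  | cons e L' =>
    rw [hLk] at h1 h2
    have h3 := GTk_time (h2 e List.mem_cons_self)
    have h4 := (h1.2.nodup_of_time fun e' he' => GTk_time (h2 e' (List.mem_cons_of_mem _ he'))).2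
      (sink P k) (by simp)
    rw [h1.1] at h3
    exact h3.trans_le h4

theorem initialNodes_time_le (P : ValidPartition I) (hfeas : ∃ z, I.FeasibleDT z) :
    ∀ p ∈ initialNodes P, p.2 ≤ I.T := by
  intro p hp
  simp only [initialNodes, Finset.mem_union, Finset.mem_image, Finset.mem_univ, true_and] at hp
  rcases hp with ((⟨k, rfl⟩ | ⟨k, rfl⟩) | ⟨v, rfl⟩) | ⟨n, rfl⟩
  · exact (release_lt_deadline P hfeas k).le.trans (le_T I k)
  · exact le_T I k
  · exact le_rfl
  · exact Nat.zero_le _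

/-- Besides all copies at time `0` there is a terminal copy at time `T`, and `T` is positive. The
extra node compensates for numbering iterations from `1`. -/
theorem card_lt_card_initialNodes [Nonempty K] (P : ValidPartition I)
    (hfeas : ∃ z, I.FeasibleDT z) : Fintype.card (AuxNode P) < (initialNodes P).card := by
  classical
  obtain ⟨k⟩ := ‹Nonempty K›
  have hT : 0 < I.T := (Nat.zero_le _).trans_lt
    ((release_lt_deadline P hfeas k).trans_le (le_T I k))
  have hinj : Function.Injective fun n : AuxNode P => (n, 0) := fun a b h => congrArg Prod.fst h
  rw [← Finset.card_univ, ← Finset.card_image_of_injective Finset.univ hinj]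
  refine Finset.card_lt_card ((Finset.ssubset_iff_of_subset fun p hp => ?_).2
    ⟨((⟨I.o k, none⟩ : AuxNode P), I.T), by simp [initialNodes], fun h => ?_⟩)
  · obtain ⟨n, -, rfl⟩ := Finset.mem_image.1 hp
    simp [initialNodes]
  · obtain ⟨n, -, hn⟩ := Finset.mem_image.1 h
    have : 0 = I.T := congrArg Prod.snd hn
    omega

/-- The timed nodes at the beginning of iteration `n`. -/
structure Iterate (P : ValidPartition I) (n : ℕ) (S : Finset (TNode (AuxNode P))) : Prop where
  initial : initialNodes P ⊆ S
  time_le : ∀ p ∈ S, p.2 ≤ I.T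
  -- At the start of iteration `n`, only `n - 1` refinements have happened, each adding at least one
  -- node.
  card_le : n + (initialNodes P).card ≤ 1 + S.card

theorem Iterate.le [Nonempty K] (hfeas : ∃ z, I.FeasibleDT z) {n : ℕ}
    {S : Finset (TNode (AuxNode P))} (h : Iterate P n S) :
    n ≤ Fintype.card (AuxNode P) * I.T := by
  have h1 := card_lt_card_initialNodes P hfeas
  have h2 : S.card ≤ Fintype.card (AuxNode P) * (I.T + 1) := by
    have hsub : S ⊆ Finset.univ ×ˢ Finset.range (I.T + 1) := fun p hp => by
      have := h.time_le p hp
      simp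
      omega
    simpa using Finset.card_le_card hsub
  have h3 := h.card_le
  rw [mul_add, mul_one] at h2
  omega

/-- What is known about a configuration that an execution of the algorithm reaches. -/
def Invariant (P : ValidPartition I) : ℕ × State P → Prop
  | (n, .lower S) => Iterate P n S
  | (n, .solved S z) => Iterate P n S ∧ OptimalGS P S z
  | (n, .routed S z Q) => Iterate P n S ∧ OptimalGS P S z ∧ TrajectoriesOf P S z.x Q
  | (n, .bounded S z Q zbar C) => Iterate P n S ∧ OptimalGS P S z ∧ TrajectoriesOf P S z.x Q ∧
      UpperBound P S z.x Q zbar C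
  | (n, .stopped zbar) => n ≤ Fintype.card (AuxNode P) * I.T ∧ OptimalGT P zbar ∧
      I.OptimalDT (project P zbar) ∧ I.costDT (project P zbar) = costGT P zbar

theorem Invariant.step [Nonempty K] (hfeas : ∃ z, I.FeasibleDT z) {c c' : ℕ × State P}
    (h : Invariant P c) (hs : Step P c c') : Invariant P c' := by
  cases hs with
  | solve h' => exact ⟨h, h'⟩
  | route h' => exact ⟨h.1, h.2, h'⟩
  | bound h' => exact ⟨h.1, h.2.1, h.2.2, h'⟩
  | finish h' =>
    obtain ⟨h1, h2, h3, h4⟩ := h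
    exact ⟨h1.le hfeas, optimal_of_cost_eq h1.initial h2 h3 h4 h'⟩
  | refine h' h'' =>
    obtain ⟨h1, h2, h3, h4⟩ := h
    obtain ⟨ha, hb, hc⟩ := h''.card_lt h3 (nonempty_of_cost_ne h1.initial h2 h3 h4 h')
    refine ⟨h1.initial.trans ha, hc h1.time_le, ?_⟩
    have := h1.card_le
    omega

theorem Invariant.le [Nonempty K] (hfeas : ∃ z, I.FeasibleDT z) {n : ℕ} {s : State P}
    (h : Invariant P (n, s)) : n ≤ Fintype.card (AuxNode P) * I.T := by
  cases s with
  | lower S => exact Iterate.le hfeas h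
  | solved S z => exact h.1.le hfeas
  | routed S z Q => exact h.1.le hfeas
  | bounded S z Q zbar C => exact h.1.le hfeas
  | stopped zbar => exact h.1

theorem Invariant.progress (hfeas : ∃ z, I.FeasibleDT z) {n : ℕ} {s : State P}
    (h : Invariant P (n, s)) : (∃ c, Step P (n, s) c) ∨
      ∃ zbar, s = .stopped zbar ∧ OptimalGT P zbar ∧ I.OptimalDT (project P zbar) ∧
        I.costDT (project P zbar) = costGT P zbar := by
  cases s with
  | lower S =>
    have h' : Iterate P n S := h
    have h0 : ∀ n, (n, 0) ∈ S := fun n => h'.initial (by simp [initialNodes])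
    obtain ⟨z, hz⟩ := hfeas
    obtain ⟨L, hw, hL, -⟩ := exists_GT_of_feasibleDT P hz
    obtain ⟨z', hz', -⟩ := exists_GS_of_walks_GT h'.initial hw hL
    obtain ⟨z'', hz''⟩ := exists_optimalGS h0 ⟨z', hz'⟩
    exact Or.inl ⟨_, .solve hz''⟩
  | solved S z =>
    obtain ⟨Q, hQ⟩ := exists_trajectories h.1.initial h.2
    exact Or.inl ⟨_, .route hQ⟩
  | routed S z Q =>
    obtain ⟨zbar, C, hub⟩ := exists_upperBound h.2.1.1 h.2.2
    exact Or.inl ⟨_, .bound hub⟩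
  | bounded S z Q zbar C =>
    obtain ⟨h1, h2, h3, h4⟩ := h
    by_cases hc : costGT P zbar = costGS P S z
    · exact Or.inl ⟨_, .finish hc⟩
    · obtain ⟨S', hS'⟩ := exists_refines h2.1 h3 h4
      exact Or.inl ⟨_, .refine hc hS'⟩
  | stopped zbar => exact Or.inr ⟨zbar, rfl, h.2⟩

theorem invariant_start (hfeas : ∃ z, I.FeasibleDT z) : Invariant P (start P) :=
  ⟨Finset.Subset.refl _, initialNodes_time_le P hfeas, le_rfl⟩

theorem Invariant.of_reflTransGen [Nonempty K] (hfeas : ∃ z, I.FeasibleDT z) {c : ℕ × State P}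
    (h : Relation.ReflTransGen (Step P) (start P) c) : Invariant P c := by
  induction h with
  | refl => exact invariant_start hfeas
  | tail _ hs ih => exact ih.step hfeas hs

/-- The position of a control state within an iteration. -/
def phase : State P → ℕ
  | .lower _ => 0
  | .solved _ _ => 1
  | .routed _ _ _ => 2
  | .bounded _ _ _ _ _ => 3
  | .stopped _ => 4

theorem phase_le (s : State P) : phase s ≤ 4 := by
  cases s <;> simp [phase]

/-- Refinement drops the phase from `3` to `0` but raises the iteration number by one, so the weight
`4` is just enough. -/
theorem Step.lt {c c' : ℕ × State P} (h : Step P c c') :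
    4 * c.1 + phase c.2 < 4 * c'.1 + phase c'.2 := by
  cases h <;> (simp [phase]; try omega)

end Formulations

end SNDRR

end

theorem mainTheorem5 {N K : Type*} [Fintype N] [DecidableEq N] [Fintype K] [Nonempty K]
    (I : SNDRR.Instance N K) (P : SNDRR.ValidPartition I)
    (hfeas : ∃ z : SNDRR.Solution N N K, I.FeasibleDT z) :
    -- no execution is infinite
    (¬ ∃ run : ℕ → ℕ × SNDRR.State P,
      run 0 = SNDRR.start P ∧ ∀ i, SNDRR.Step P (run i) (run (i + 1))) ∧
    -- every configuration that an execution reaches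
    (∀ (n : ℕ) (s : SNDRR.State P),
      Relation.ReflTransGen (SNDRR.Step P) (SNDRR.start P) (n, s) →
        -- belongs to one of the first `|V| * T` iterations,
        n ≤ Fintype.card (SNDRR.AuxNode P) * I.T ∧
        -- and either can be continued or has stopped with an optimal solution
        ((∃ c, SNDRR.Step P (n, s) c) ∨
          ∃ zbar, s = .stopped zbar ∧ SNDRR.OptimalGT P zbar ∧
            I.OptimalDT (SNDRR.project P zbar) ∧
            I.costDT (SNDRR.project P zbar) = SNDRR.costGT P zbar)) := by
  refine ⟨?_, fun n s h => ?_⟩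
  · rintro ⟨run, h0, hstep⟩
    have hreach : ∀ i, Relation.ReflTransGen (SNDRR.Step P) (SNDRR.start P) (run i) ∧
        i ≤ 4 * (run i).1 + SNDRR.phase (run i).2 := by
      intro i
      induction i with
      | zero => exact ⟨h0 ▸ Relation.ReflTransGen.refl, Nat.zero_le _⟩
      | succ i ih =>
        have := (hstep i).lt
        exact ⟨ih.1.tail (hstep i), by omega⟩
    -- The measure never exceeds four times the iteration bound plus the largest phase `4`, so one
    -- more step is already too many.
    obtain ⟨h1, h2⟩ := hreach (4 * (Fintype.card (SNDRR.AuxNode P) * I.T) + 5)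
    have h3 := (SNDRR.Invariant.of_reflTransGen hfeas h1).le hfeas
    have h4 := SNDRR.phase_le (run (4 * (Fintype.card (SNDRR.AuxNode P) * I.T) + 5)).2
    omega
  · have hinv := SNDRR.Invariant.of_reflTransGen hfeas h
    exact ⟨hinv.le hfeas, hinv.progress hfeas⟩
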